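/- Let $(\mathfrak H,(\cdot,\cdot))$ be a complex Hilbert space and $J$ a non-trivial fundamental symmetry in $\mathfrak H$, i.e. a bounded operator with $J=J^*$, $J^2=I$, $J\neq\pm I$; put $\mathfrak H_\pm=\frac12(I\pm J)\mathfrak H$. Let $S$ be a closed densely defined symmetric operator in $\mathfrak H$ with $SJ=JS$ such that its restrictions $S_\pm=S\upharpoonright\mathfrak H_\pm$, as operators in $\mathfrak H_\pm$, have deficiency indices $\langle 1,1\rangle$. For an operator $T$ put $\mathfrak N_\mu(T)=\ker(T^*-\mu I)$, and $\mathfrak N_\mu=\mathfrak N_\mu(S)$. Assume that $S$ is simple (it induces a self-adjoint operator in no nonzero closed subspace) and that its characteristic function $$\mathsf{Sh}(\mu)=(A_\mu-iI)(A_\mu+iI)^{-1}\upharpoonright_{\mathfrak N_i},\qquad A_\mu=S^*\upharpoonright_{\mathcal D(S)\dotplus\mathfrak N_\mu},$$ vanishes for all $\mu$ with $\operatorname{Im}\mu>0$. An operator $A$ is $J$-self-adjoint if it is densely defined and $JA^*J=A$. Let $\Sigma_J$ be the set of all $J$-self-adjoint extensions of $S$, and let $\mathfrak U$ be the set of all bounded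 operators $C$ in $\mathfrak H$ with $C^2=I$, $JC>0$, $SC=CS$. Put $$\Upsilon_{\mathfrak U}=\{A\in\Sigma_J : AC=CA\ \ \forall C\in\mathfrak U\},\qquad \Upsilon_J=\{A\in\Sigma_J : AJ=JA\},\qquad \Sigma_J^{st}=\{A\in\Sigma_J : \exists\, C\in\mathfrak U,\ AC=CA\}.$$ Let $e_{++},e_{+-},e_{-+},e_{--}$ be any vectors of equal norm spanning, respectively, the one-dimensional spaces $\mathfrak N_i(S_+)$, $\mathfrak N_i(S_-)$, $\mathfrak N_{-i}(S_+)$, $\mathfrak N_{-i}(S_-)$. For a unitary matrix $U=(u_{jk})\in\mathbb C^{2\times2}$ let $A_U=S^*\upharpoonright_{\mathcal D(S)\dotplus M_U}$, where $M_U=\operatorname{span}\{d_1,d_2\}$, $$d_1=e_{++}+u_{11}e_{+-}+u_{12}e_{-+},\qquad d_2=e_{--}+u_{21}e_{+-}+u_{22}e_{-+}.$$ Then $\Upsilon_{\mathfrak U}=\emptyset$, and the inclusions $\Upsilon_{\mathfrak U}\subset\Upsilon_J\subset\Sigma_J^{st}$ hold and are both strict. Moreover, for every unitary $U$: (i) $A_U\in\Upsilon_J$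 if and only if $$U=e^{i\phi}\begin{pmatrix}0&e^{i\xi}\\-e^{-i\xi}&0\end{pmatrix}\quad\text{for some }\phi,\xi\in[0,2\pi);$$ (ii) $A_U\in\Sigma_J^{st}\setminus\Upsilon_J$ if and only if $$U=e^{i\phi}\begin{pmatrix}qe^{i\gamma}&re^{i\xi}\\-re^{-i\xi}&qe^{-i\gamma}\end{pmatrix}\quad\text{for some }\phi,\gamma,\xi\in[0,2\pi),\ q,r>0,\ q^2+r^2=1.$$ -/

import Mathlib

noncomputable section

namespace KreinExt

/-! Unbounded operators in a complex Hilbert space are `LinearPMap`s, `H →ₗ.[ℂ] H`. -/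

section Algebra

variable {H : Type*} [AddCommGroup H] [Module ℂ H]

/-- The product `B A` of two unbounded operators, with its natural domain
`{x ∈ D(A) | A x ∈ D(B)}`. -/
def opMul (B A : H →ₗ.[ℂ] H) : H →ₗ.[ℂ] H where
  domain := (B.domain.comap A.toFun).map A.domain.subtype
  toFun :=
    { toFun := fun x => B ⟨A ⟨x.1, by
          obtain ⟨y, _, hyx⟩ := Submodule.mem_map.1 x.2
          rw [← hyx]; exact y.2⟩, by
          obtain ⟨y, hy, hyx⟩ := Submodule.mem_map.1 x.2
          have e : (⟨x.1, by rw [← hyx]; exact y.2⟩ : A.domain) = y := Subtype.ext hyx.symm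
          rw [e]; exact hy⟩
      map_add' := fun x y => by
        rw [← LinearPMap.map_add]
        congr 1
        apply Subtype.ext
        exact LinearPMap.map_add A ⟨x.1, _⟩ ⟨y.1, _⟩
      map_smul' := fun c x => by
        rw [RingHom.id_apply, ← LinearPMap.map_smul]
        congr 1
        apply Subtype.ext
        exact LinearPMap.map_smul A c ⟨x.1, _⟩ }

/-- An everywhere defined operator, regarded as an unbounded operator. -/
def everywhere (C : H →ₗ[ℂ] H) : H →ₗ.[ℂ] H := C.toPMap ⊤

/-- `A - z I`, with domain `D(A)`. -/
def subScalar (A : H →ₗ.[ℂ] H) (z : ℂ) : H →ₗ.[ℂ] H :=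
  A - everywhere (z • LinearMap.id)

/-- The part of the operator `A` in the subspace `K`, as an operator in `K`: its domain is
`{x ∈ K ∩ D(A) | A x ∈ K}`. If `A` maps `D(A) ∩ K` into `K`, this is the restriction `A ↾ K`. -/
def part (A : H →ₗ.[ℂ] H) (K : Submodule ℂ H) : K →ₗ.[ℂ] K where
  domain := ((K.comap A.toFun).map A.domain.subtype).comap K.subtype
  toFun :=
    { toFun := fun x => ⟨A ⟨x.1.1, by
          obtain ⟨y, _, hyx⟩ := Submodule.mem_map.1 (Submodule.mem_comap.1 x.2)
          have e : (y : H) = x.1.1 := hyx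
          rw [← e]; exact y.2⟩, by
          obtain ⟨y, hy, hyx⟩ := Submodule.mem_map.1 (Submodule.mem_comap.1 x.2)
          have e : (⟨x.1.1, by
            have e' : (y : H) = x.1.1 := hyx
            rw [← e']; exact y.2⟩ : A.domain) = y := Subtype.ext hyx.symm
          rw [e]; exact hy⟩
      map_add' := fun x y => by
        apply Subtype.ext
        exact LinearPMap.map_add A ⟨x.1.1, _⟩ ⟨y.1.1, _⟩
      map_smul' := fun c x => by
        apply Subtype.ext
        exact LinearPMap.map_smul A c ⟨x.1.1, _⟩ }

end Algebra

variable {H : Type*} [NormedAddCommGroup H] [InnerProductSpace ℂ H]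

/-- `A C = C A` as an equality of unbounded operators (equal domains included), `C` bounded. -/
def Commutes (A : H →ₗ.[ℂ] H) (C : H →L[ℂ] H) : Prop :=
  opMul A (everywhere (C : H →ₗ[ℂ] H)) = opMul (everywhere (C : H →ₗ[ℂ] H)) A

variable [CompleteSpace H]

/-- A non-trivial fundamental symmetry: `J = J*`, `J² = I`, `J ≠ ± I`. -/
structure FundamentalSymmetry (H : Type*) [NormedAddCommGroup H] [InnerProductSpace ℂ H]
    [CompleteSpace H] where
  op : H →L[ℂ] H
  isSelfAdjoint : IsSelfAdjoint op
  sq_eq_one : op * op = 1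
  ne_one : op ≠ 1
  ne_neg_one : op ≠ -1

namespace FundamentalSymmetry

variable (J : FundamentalSymmetry H)

/-- `H₊ = P₊ H`, where `P₊ = (I + J) / 2`. -/
def plus : Submodule ℂ H :=
  LinearMap.range (((1 / 2 : ℂ) • (1 + J.op) : H →L[ℂ] H) : H →ₗ[ℂ] H)

/-- `H₋ = P₋ H`, where `P₋ = (I - J) / 2`. -/
def minus : Submodule ℂ H :=
  LinearMap.range (((1 / 2 : ℂ) • (1 - J.op) : H →L[ℂ] H) : H →ₗ[ℂ] H)

theorem op_op (x : H) : J.op (J.op x) = x := by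
  have h := congrArg (fun T : H →L[ℂ] H => T x) J.sq_eq_one
  simpa using h

theorem mem_plus (x : H) : x ∈ J.plus ↔ J.op x = x := by
  constructor
  · rintro ⟨y, rfl⟩
    simp [J.op_op, add_comm]
  · intro h
    refine ⟨x, ?_⟩
    simp only [ContinuousLinearMap.coe_coe, smul_apply,
      add_apply, one_apply_eq_self, h]
    rw [← two_smul ℂ x, smul_smul]
    norm_num

theorem mem_minus (x : H) : x ∈ J.minus ↔ J.op x = -x := by
  constructor
  · rintro ⟨y, rfl⟩
    simp [J.op_op, ← smul_neg]
  · intro h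
    refine ⟨x, ?_⟩
    simp only [ContinuousLinearMap.coe_coe, smul_apply,
      sub_apply, one_apply_eq_self, h]
    rw [sub_neg_eq_add, ← two_smul ℂ x, smul_smul]
    norm_num

instance instCompletePlus : CompleteSpace J.plus := by
  have h : IsClosed (J.plus : Set H) := by
    have e : (J.plus : Set H) = {x | J.op x = x} := Set.ext fun x => J.mem_plus x
    rw [e]
    exact isClosed_eq J.op.continuous continuous_id
  exact h.completeSpace_coe

instance instCompleteMinus : CompleteSpace J.minus := by
  have h : IsClosed (J.minus : Set H) := by
    have e : (J.minus : Set H) = {x | J.op x = -x} := Set.ext fun x => J.mem_minus x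
    rw [e]
    exact isClosed_eq J.op.continuous continuous_neg
  exact h.completeSpace_coe

end FundamentalSymmetry

/-- The defect subspace `N_μ = ker (S* - μ I)`. -/
def defectSpace (S : H →ₗ.[ℂ] H) (μ : ℂ) : Submodule ℂ H where
  carrier := {x | ∃ h : x ∈ S.adjoint.domain, S.adjoint ⟨x, h⟩ = μ • x}
  zero_mem' := ⟨Submodule.zero_mem _, by
    rw [smul_zero]; exact LinearPMap.map_zero S.adjoint⟩
  add_mem' := by
    rintro x y ⟨hx, ex⟩ ⟨hy, ey⟩
    refine ⟨Submodule.add_mem _ hx hy, ?_⟩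
    rw [smul_add, ← ex, ← ey]
    exact LinearPMap.map_add S.adjoint ⟨x, hx⟩ ⟨y, hy⟩
  smul_mem' := by
    rintro c x ⟨hx, ex⟩
    refine ⟨Submodule.smul_mem _ c hx, ?_⟩
    rw [smul_comm, ← ex]
    exact LinearPMap.map_smul S.adjoint c ⟨x, hx⟩

/-- `S` has deficiency indices `<1, 1>`. -/
def HasDeficiencyIndicesOne (S : H →ₗ.[ℂ] H) : Prop :=
  Module.finrank ℂ (defectSpace S Complex.I) = 1 ∧
    Module.finrank ℂ (defectSpace S (-Complex.I)) = 1

/-- `S` is simple: there is no nonzero closed subspace in which `S` induces a self-adjoint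
operator. (For symmetric `S`, a closed subspace in which the part of `S` is self-adjoint
automatically reduces `S`.) -/
def IsSimple (S : H →ₗ.[ℂ] H) : Prop :=
  ∀ (K : Submodule ℂ H) [CompleteSpace K], IsSelfAdjoint (part S K) → K = ⊥

/-- `A_μ = S* ↾ (D(S) + N_μ)`. -/
def dissipativeExt (S : H →ₗ.[ℂ] H) (μ : ℂ) : H →ₗ.[ℂ] H :=
  S.adjoint.domRestrict (S.domain ⊔ defectSpace S μ)

/-- The (Straus) characteristic function `Sh(μ) = (A_μ - i I) (A_μ + i I)⁻¹ ↾ N_i` of `S`,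
for `μ` in the open upper half-plane. -/
def charFunction (S : H →ₗ.[ℂ] H) (μ : ℂ) : H →ₗ.[ℂ] H :=
  (opMul (subScalar (dissipativeExt S μ) Complex.I)
    (subScalar (dissipativeExt S μ) (-Complex.I)).inverse).domRestrict (defectSpace S Complex.I)

/-- `Sh(μ)` is the zero operator on `N_i` for every `μ` in the open upper half-plane. -/
def HasZeroCharFunction (S : H →ₗ.[ℂ] H) : Prop :=
  ∀ μ : ℂ, 0 < μ.im →
    charFunction S μ = (0 : H →ₗ[ℂ] H).toPMap (defectSpace S Complex.I)

section Extensions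

variable (J : FundamentalSymmetry H) (S : H →ₗ.[ℂ] H)

/-- The adjoint `J A* J` of `A` with respect to the indefinite inner product `(J ·, ·)`. -/
def kreinAdjoint (A : H →ₗ.[ℂ] H) : H →ₗ.[ℂ] H :=
  opMul (everywhere (J.op : H →ₗ[ℂ] H))
    (opMul A.adjoint (everywhere (J.op : H →ₗ[ℂ] H)))

/-- `A` is `J`-self-adjoint. -/
def IsJSelfAdjoint (A : H →ₗ.[ℂ] H) : Prop :=
  Dense (A.domain : Set H) ∧ kreinAdjoint J A = A

/-- `Σ_J`: all `J`-self-adjoint extensions of `S`. -/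
def SigmaJ : Set (H →ₗ.[ℂ] H) := {A | S ≤ A ∧ IsJSelfAdjoint J A}

/-- `𝔘`: all bounded `C` with `C² = I`, `J C > 0` and `S C = C S`. -/
def CSymmetries : Set (H →L[ℂ] H) :=
  {C | C * C = 1 ∧
    (IsSelfAdjoint (J.op * C) ∧ ∀ x : H, x ≠ 0 → 0 < (inner ℂ ((J.op * C) x) x).re) ∧
    Commutes S C}

/-- `Υ_J`: the extensions in `Σ_J` that commute with `J`. -/
def UpsilonJ : Set (H →ₗ.[ℂ] H) := {A | A ∈ SigmaJ J S ∧ Commutes A J.op}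

/-- `Σ_J^{st}`: the extensions in `Σ_J` that commute with some `C ∈ 𝔘`. -/
def SigmaJst : Set (H →ₗ.[ℂ] H) :=
  {A | A ∈ SigmaJ J S ∧ ∃ C ∈ CSymmetries J S, Commutes A C}

/-- `Υ_𝔘`: the extensions in `Σ_J` that commute with every `C ∈ 𝔘`. -/
def UpsilonU : Set (H →ₗ.[ℂ] H) :=
  {A | A ∈ SigmaJ J S ∧ ∀ C ∈ CSymmetries J S, Commutes A C}

/-- Vectors `e_{++}, e_{+-}, e_{-+}, e_{--}` spanning the one-dimensional defect subspaces
`N_i(S₊), N_i(S₋), N_{-i}(S₊), N_{-i}(S₋)` of the parts `S₊, S₋` of `S` in `H₊, H₋`, and having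
equal norms. (On `N_i` and on `N_{-i}` the norm of `𝔐 = N_i + N_{-i}` is `√2` times the norm of
`H`, and the four vectors are automatically orthogonal in `𝔐`.) -/
structure DefectBasis where
  epp : J.plus
  epm : J.minus
  emp : J.plus
  emm : J.minus
  span_epp : Submodule.span ℂ {epp} = defectSpace (part S J.plus) Complex.I
  span_epm : Submodule.span ℂ {epm} = defectSpace (part S J.minus) Complex.I
  span_emp : Submodule.span ℂ {emp} = defectSpace (part S J.plus) (-Complex.I)
  span_emm : Submodule.span ℂ {emm} = defectSpace (part S J.minus) (-Complex.I)
  norm_epm : ‖epm‖ = ‖epp‖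
  norm_emp : ‖emp‖ = ‖epp‖
  norm_emm : ‖emm‖ = ‖epp‖

variable {J S}

/-- `M_U = span {d₁, d₂}`, `d₁ = e_{++} + U₁₁ e_{+-} + U₁₂ e_{-+}`,
`d₂ = e_{--} + U₂₁ e_{+-} + U₂₂ e_{-+}`. -/
def neutralSpace (e : DefectBasis J S) (U : Matrix (Fin 2) (Fin 2) ℂ) : Submodule ℂ H :=
  Submodule.span ℂ
    {(e.epp : H) + U 0 0 • (e.epm : H) + U 0 1 • (e.emp : H),
     (e.emm : H) + U 1 0 • (e.epm : H) + U 1 1 • (e.emp : H)}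

/-- `A_U = S* ↾ (D(S) + M_U)`. -/
def extOfMatrix (e : DefectBasis J S) (U : Matrix (Fin 2) (Fin 2) ℂ) : H →ₗ.[ℂ] H :=
  S.adjoint.domRestrict (S.domain ⊔ neutralSpace e U)

end Extensions

end KreinExt

end

/-!
As `Sh` vanishes, `N_i` and `N_{-i}` are orthogonal under all powers of the Cayley transform `T` of
`S`, so the orbits of the defect vectors, of `N_i` under `T*` and of `N_{-i}` under `T`, consist of
pairwise orthogonal vectors of equal norm. They span `H` because `S` is simple. Permuting the four
orbits gives, for all phases `d`, a unitary involution `R` that commutes with `S`, anticommutes with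
`J` and swaps the defect vectors of `S₊` with those of `S₋`. For `a² - b² = 1` and `a > 0`, the
operator `J (a + b R)` is in `𝔘`. An extension commuting with all of them commutes with every `R`,
hence with a sign change on `N_{-i}`; this leaves only `S`, which is not `J`-self-adjoint. On the
other hand `A_U` is given by the graph of `U` in the defect space, and suitable `d`, `a`, `b` make
`J (a + b R)` preserve this graph as soon as `u₁₂ ≠ 0`. If `u₁₂ = 0`, then `d₁` is an eigenvector of
`A_U` for the eigenvalue `i`, which a positive `J C` excludes.
-/

namespace KreinExt

open Complex (I)
open ContinuousLinearMap (adjoint)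
open scoped InnerProductSpace ComplexConjugate Matrix

section Graph

variable {R E F : Type*} [Ring R] [AddCommGroup E] [Module R E] [AddCommGroup F] [Module R F]

theorem mem_graph_iff_exists {A : E →ₗ.[R] F} {x : E} {y : F} :
    (x, y) ∈ A.graph ↔ ∃ h : x ∈ A.domain, A ⟨x, h⟩ = y := by
  rw [LinearPMap.mem_graph_iff]
  constructor
  · rintro ⟨z, rfl, h⟩
    exact ⟨z.2, h⟩
  · rintro ⟨h, e⟩
    exact ⟨⟨x, h⟩, rfl, e⟩

theorem graph_ext {A B : E →ₗ.[R] F} (h : ∀ x y, (x, y) ∈ A.graph ↔ (x, y) ∈ B.graph) : A = B :=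
  LinearPMap.eq_of_eq_graph (Submodule.ext fun p => h p.1 p.2)

theorem add_mem_graph {A : E →ₗ.[R] F} {x x' : E} {y y' : F} (h : (x, y) ∈ A.graph)
    (h' : (x', y') ∈ A.graph) : (x + x', y + y') ∈ A.graph :=
  A.graph.add_mem h h'

theorem sub_mem_graph {A : E →ₗ.[R] F} {x x' : E} {y y' : F} (h : (x, y) ∈ A.graph)
    (h' : (x', y') ∈ A.graph) : (x - x', y - y') ∈ A.graph :=
  A.graph.sub_mem h h'

theorem smul_mem_graph {A : E →ₗ.[R] F} {x : E} {y : F} (c : R) (h : (x, y) ∈ A.graph) :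
    (c • x, c • y) ∈ A.graph :=
  A.graph.smul_mem c h

theorem mem_graph_domRestrict {A : E →ₗ.[R] F} {D : Submodule R E} {x : E} {y : F} :
    (x, y) ∈ (A.domRestrict D).graph ↔ x ∈ D ∧ (x, y) ∈ A.graph := by
  simp only [mem_graph_iff_exists]
  exact ⟨fun ⟨h, e⟩ => ⟨h.1, h.2, e⟩, fun ⟨hD, h, e⟩ => ⟨⟨hD, h⟩, e⟩⟩

theorem mem_graph_inverse {A : E →ₗ.[R] F} (hA : ∀ x, (x, (0 : F)) ∈ A.graph → x = 0) {x : F}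
    {y : E} : (x, y) ∈ A.inverse.graph ↔ (y, x) ∈ A.graph := by
  have hker : LinearMap.ker A.toFun = ⊥ :=
    LinearMap.ker_eq_bot'.2 fun z hz => Subtype.ext (hA z (mem_graph_iff_exists.2 ⟨z.2, hz⟩))
  rw [LinearPMap.inverse_graph hker]
  exact ⟨fun ⟨_, h, e⟩ => by cases e; exact h, fun h => ⟨(y, x), h, rfl⟩⟩

end Graph

section Operations

variable {H : Type*} [AddCommGroup H] [Module ℂ H]

theorem mem_graph_opMul {A B : H →ₗ.[ℂ] H} {x z : H} :
    (x, z) ∈ (opMul B A).graph ↔ ∃ y, (x, y) ∈ A.graph ∧ (y, z) ∈ B.graph := by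
  simp only [mem_graph_iff_exists]
  constructor
  · rintro ⟨h, e⟩
    obtain ⟨y, hy, rfl⟩ := Submodule.mem_map.1 h
    exact ⟨A y, ⟨y.2, rfl⟩, hy, e⟩
  · rintro ⟨y, ⟨h, rfl⟩, hb, e⟩
    exact ⟨Submodule.mem_map.2 ⟨⟨x, h⟩, hb, rfl⟩, e⟩

theorem mem_graph_everywhere {C : H →ₗ[ℂ] H} {x y : H} :
    (x, y) ∈ (everywhere C).graph ↔ C x = y := by
  rw [mem_graph_iff_exists]
  exact ⟨fun ⟨_, e⟩ => e, fun e => ⟨Submodule.mem_top, e⟩⟩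

theorem mem_graph_subScalar {A : H →ₗ.[ℂ] H} {z : ℂ} {x y : H} :
    (x, y) ∈ (subScalar A z).graph ↔ (x, y + z • x) ∈ A.graph := by
  simp only [mem_graph_iff_exists]
  exact ⟨fun ⟨h, e⟩ => ⟨h.1, sub_eq_iff_eq_add.1 e⟩,
    fun ⟨h, e⟩ => ⟨⟨h, Submodule.mem_top⟩, sub_eq_iff_eq_add.2 e⟩⟩

theorem mem_graph_part {A : H →ₗ.[ℂ] H} {K : Submodule ℂ H} {x y : K} :
    (x, y) ∈ (part A K).graph ↔ ((x : H), (y : H)) ∈ A.graph := by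
  simp only [mem_graph_iff_exists]
  constructor
  · rintro ⟨h, e⟩
    obtain ⟨z, -, hzx⟩ := Submodule.mem_map.1 (Submodule.mem_comap.1 h)
    exact ⟨(show (z : H) = x from hzx) ▸ z.2, congrArg Subtype.val e⟩
  · rintro ⟨h, e⟩
    exact ⟨Submodule.mem_comap.2 (Submodule.mem_map.2
      ⟨⟨x, h⟩, (show A ⟨x, h⟩ ∈ K from e ▸ y.2), rfl⟩), Subtype.ext e⟩

end Operations

section MapsGraph

variable {H : Type*} [NormedAddCommGroup H] [InnerProductSpace ℂ H]

/-- `C A ⊆ A C`: the bounded operator `C` maps the graph of `A` into itself. For an involution `C`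
this is the commutation `A C = C A`. -/
def MapsGraph (A : H →ₗ.[ℂ] H) (C : H →L[ℂ] H) : Prop :=
  ∀ ⦃x y : H⦄, (x, y) ∈ A.graph → (C x, C y) ∈ A.graph

theorem commutes_iff {A : H →ₗ.[ℂ] H} {C : H →L[ℂ] H} :
    Commutes A C ↔ ∀ x z, (C x, z) ∈ A.graph ↔ ∃ y, (x, y) ∈ A.graph ∧ C y = z := by
  have h_left (x z) : (x, z) ∈ (opMul A (everywhere (C : H →ₗ[ℂ] H))).graph ↔
      (C x, z) ∈ A.graph := by
    simp only [mem_graph_opMul, mem_graph_everywhere, ContinuousLinearMap.coe_coe, exists_eq_left']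
  have h_right (x z) : (x, z) ∈ (opMul (everywhere (C : H →ₗ[ℂ] H)) A).graph ↔
      ∃ y, (x, y) ∈ A.graph ∧ C y = z := by
    simp only [mem_graph_opMul, mem_graph_everywhere, ContinuousLinearMap.coe_coe]
  refine ⟨fun h x z => ?_, fun h => graph_ext fun x z => ?_⟩
  · rw [← h_left, ← h_right, show opMul A _ = _ from h]
  · rw [h_left, h_right, h]

theorem Commutes.mapsGraph {A : H →ₗ.[ℂ] H} {C : H →L[ℂ] H} (h : Commutes A C) : MapsGraph A C :=
  fun x y hxy => (commutes_iff.1 h x (C y)).2 ⟨y, hxy, rfl⟩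

theorem apply_apply_of_mul_self {C : H →L[ℂ] H} (hC : C * C = 1) (x : H) : C (C x) = x :=
  DFunLike.congr_fun hC x

namespace MapsGraph

variable {A : H →ₗ.[ℂ] H} {B C : H →L[ℂ] H}

theorem commutes (h : MapsGraph A C) (hC : C * C = 1) : Commutes A C := by
  rw [commutes_iff]
  refine fun x z => ⟨fun hx => ⟨C z, ?_, apply_apply_of_mul_self hC z⟩, ?_⟩
  · simpa only [apply_apply_of_mul_self hC] using h hx
  · rintro ⟨y, hxy, rfl⟩
    exact h hxy

theorem add (hB : MapsGraph A B) (hC : MapsGraph A C) : MapsGraph A (B + C) :=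
  fun _ _ h => add_mem_graph (hB h) (hC h)

theorem smul (c : ℂ) (hC : MapsGraph A C) : MapsGraph A (c • C) :=
  fun _ _ h => smul_mem_graph c (hC h)

theorem mul (hB : MapsGraph A B) (hC : MapsGraph A C) : MapsGraph A (B * C) :=
  fun _ _ h => hB (hC h)

theorem one : MapsGraph A 1 :=
  fun _ _ h => h

end MapsGraph

end MapsGraph

section Adjoint

variable {H : Type*} [NormedAddCommGroup H] [InnerProductSpace ℂ H] [CompleteSpace H]

theorem mem_graph_adjoint {A : H →ₗ.[ℂ] H} (hA : Dense (A.domain : Set H)) {x y : H} :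
    (x, y) ∈ A.adjoint.graph ↔ ∀ u v, (u, v) ∈ A.graph → ⟪v, x⟫_ℂ = ⟪u, y⟫_ℂ := by
  rw [LinearPMap.adjoint_graph_eq_graph_adjoint hA, Submodule.mem_adjoint_iff]
  simp only [sub_eq_zero]

theorem MapsGraph.adjoint {A : H →ₗ.[ℂ] H} (hA : Dense (A.domain : Set H)) {C : H →L[ℂ] H}
    (hC : MapsGraph A (adjoint C)) : MapsGraph A.adjoint C := by
  intro x y h
  rw [mem_graph_adjoint hA] at h ⊢
  intro u v huv
  rw [← ContinuousLinearMap.adjoint_inner_left, ← ContinuousLinearMap.adjoint_inner_left]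
  exact h _ _ (hC huv)

theorem mem_defectSpace {A : H →ₗ.[ℂ] H} {μ : ℂ} {x : H} :
    x ∈ defectSpace A μ ↔ (x, μ • x) ∈ A.adjoint.graph := by
  rw [mem_graph_iff_exists]
  exact Iff.rfl

theorem mem_defectSpace_iff_inner {A : H →ₗ.[ℂ] H} (hA : Dense (A.domain : Set H)) {μ : ℂ}
    {x : H} : x ∈ defectSpace A μ ↔ ∀ u v, (u, v) ∈ A.graph → ⟪v, x⟫_ℂ = μ * ⟪u, x⟫_ℂ := by
  simp only [mem_defectSpace, mem_graph_adjoint hA, inner_smul_right]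

theorem MapsGraph.apply_mem_defectSpace {A : H →ₗ.[ℂ] H} {C : H →L[ℂ] H}
    (hC : MapsGraph A.adjoint C) {μ : ℂ} {x : H} (hx : x ∈ defectSpace A μ) :
    C x ∈ defectSpace A μ := by
  simpa only [mem_defectSpace, map_smul] using hC (mem_defectSpace.1 hx)

end Adjoint

section Symmetric

variable {H : Type*} [NormedAddCommGroup H] [InnerProductSpace ℂ H] {A : H →ₗ.[ℂ] H}

theorem inner_eq_of_mem_graph (hA : A.IsFormalAdjoint A) {u v u' v' : H}
    (h : (u, v) ∈ A.graph) (h' : (u', v') ∈ A.graph) : ⟪v, u'⟫_ℂ = ⟪u, v'⟫_ℂ := by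
  obtain ⟨hu, rfl⟩ := mem_graph_iff_exists.1 h
  obtain ⟨hu', rfl⟩ := mem_graph_iff_exists.1 h'
  exact hA ⟨u, hu⟩ ⟨u', hu'⟩

theorem im_inner_eq_zero_of_mem_graph (hA : A.IsFormalAdjoint A) {u v : H}
    (h : (u, v) ∈ A.graph) : (⟪u, v⟫_ℂ).im = 0 := by
  rw [← Complex.conj_eq_iff_im, inner_conj_symm]
  exact inner_eq_of_mem_graph hA h h

theorem norm_add_smul_sq_of_mem_graph (hA : A.IsFormalAdjoint A) {u v : H}
    (h : (u, v) ∈ A.graph) {ε : ℂ} (hε : ε = I ∨ ε = -I) :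
    ‖v + ε • u‖ ^ 2 = ‖v‖ ^ 2 + ‖u‖ ^ 2 := by
  have hre : (⟪v, ε • u⟫_ℂ).re = 0 := by
    have him := im_inner_eq_zero_of_mem_graph hA h
    rw [inner_smul_right, inner_eq_of_mem_graph hA h h]
    rcases hε with rfl | rfl <;> simp [him]
  have hnorm : ‖ε‖ = 1 := by rcases hε with rfl | rfl <;> simp
  rw [norm_add_sq (𝕜 := ℂ), norm_smul, hnorm]
  simp [hre]

theorem inner_sub_I_smul_of_mem_graph (hA : A.IsFormalAdjoint A) {u v u' v' : H}
    (h : (u, v) ∈ A.graph) (h' : (u', v') ∈ A.graph) :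
    ⟪v - I • u, v' - I • u'⟫_ℂ = ⟪v + I • u, v' + I • u'⟫_ℂ := by
  simp only [inner_add_left, inner_add_right, inner_sub_left, inner_sub_right, inner_smul_left,
    inner_smul_right, inner_eq_of_mem_graph hA h h', Complex.conj_I]
  ring

theorem inner_shift_eq_of_mem_graph (hA : A.IsFormalAdjoint A) {u v u' v' : H}
    (h : (u, v) ∈ A.graph) (h' : (u', v') ∈ A.graph) :
    ⟪v' + -I • u', u⟫_ℂ = ⟪u', v + I • u⟫_ℂ := by
  rw [inner_add_left, inner_add_right, inner_smul_left, inner_smul_right,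
    inner_eq_of_mem_graph hA h' h, map_neg, Complex.conj_I, neg_neg]

/-- `A + ε I`, as a bounded operator `(u, A u) ↦ A u + ε u` on the graph of `A`. -/
def shiftMap (A : H →ₗ.[ℂ] H) (ε : ℂ) : A.graph →L[ℂ] H :=
  (ContinuousLinearMap.snd ℂ H H + ε • ContinuousLinearMap.fst ℂ H H) ∘L A.graph.subtypeL

theorem shiftMap_apply (A : H →ₗ.[ℂ] H) (ε : ℂ) (p : A.graph) :
    shiftMap A ε p = p.1.2 + ε • p.1.1 := rfl

theorem norm_le_norm_shiftMap (hA : A.IsFormalAdjoint A) {ε : ℂ} (hε : ε = I ∨ ε = -I)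
    (p : A.graph) : ‖p‖ ≤ ‖shiftMap A ε p‖ := by
  have h := norm_add_smul_sq_of_mem_graph hA p.2 hε
  refine max_le ?_ ?_ <;> refine le_of_sq_le_sq ?_ (norm_nonneg _) <;> rw [shiftMap_apply, h]
  · exact le_add_of_nonneg_left (sq_nonneg _)
  · exact le_add_of_nonneg_right (sq_nonneg _)

theorem antilipschitz_shiftMap (hA : A.IsFormalAdjoint A) {ε : ℂ} (hε : ε = I ∨ ε = -I) :
    AntilipschitzWith 1 (shiftMap A ε) :=
  AddMonoidHomClass.antilipschitz_of_bound _ fun p => by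
    simpa using norm_le_norm_shiftMap hA hε p

theorem norm_shiftMap_neg_I (hA : A.IsFormalAdjoint A) (p : A.graph) :
    ‖shiftMap A (-I) p‖ = ‖shiftMap A I p‖ := by
  rw [← sq_eq_sq₀ (norm_nonneg _) (norm_nonneg _), shiftMap_apply, shiftMap_apply,
    norm_add_smul_sq_of_mem_graph hA p.2 (.inl rfl),
    norm_add_smul_sq_of_mem_graph hA p.2 (.inr rfl)]

variable [CompleteSpace H]

theorem isClosed_range_shiftMap (hA : A.IsFormalAdjoint A) (hc : A.IsClosed) {ε : ℂ}
    (hε : ε = I ∨ ε = -I) : IsClosed ((shiftMap A ε).range : Set H) := by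
  have : CompleteSpace A.graph := IsClosed.completeSpace_coe (hs := hc)
  rw [LinearMap.coe_range]
  exact (antilipschitz_shiftMap hA hε).isClosed_range (shiftMap A ε).uniformContinuous

theorem orthogonal_range_shiftMap (hA : Dense (A.domain : Set H)) {ε : ℂ} (hε : ε = I ∨ ε = -I) :
    (shiftMap A ε).rangeᗮ = defectSpace A ε := by
  have hconj : conj ε = -ε := by rcases hε with rfl | rfl <;> simp
  have key (u v x : H) : ⟪v + ε • u, x⟫_ℂ = 0 ↔ ⟪v, x⟫_ℂ = ε * ⟪u, x⟫_ℂ := by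
    rw [inner_add_left, inner_smul_left, hconj, neg_mul, ← sub_eq_add_neg, sub_eq_zero]
  ext x
  rw [Submodule.mem_orthogonal, mem_defectSpace_iff_inner hA]
  constructor
  · intro h u v huv
    exact (key u v x).1 (h _ ⟨⟨(u, v), huv⟩, rfl⟩)
  · rintro h _ ⟨⟨⟨u, v⟩, huv⟩, rfl⟩
    exact (key u v x).2 (h u v huv)

theorem inner_add_smul_eq_zero (hA : Dense (A.domain : Set H)) {ε : ℂ} (hε : ε = I ∨ ε = -I)
    {u v n : H} (h : (u, v) ∈ A.graph) (hn : n ∈ defectSpace A ε) : ⟪v + ε • u, n⟫_ℂ = 0 := by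
  rw [← orthogonal_range_shiftMap hA hε] at hn
  exact hn _ ⟨⟨(u, v), h⟩, rfl⟩

theorem mem_graph_adjoint_of_mem (hA : Dense (A.domain : Set H)) (hs : A.IsFormalAdjoint A)
    {u v : H} (h : (u, v) ∈ A.graph) : (u, v) ∈ A.adjoint.graph :=
  LinearPMap.le_graph_of_le (hs.le_adjoint hA) h

end Symmetric

/-- A closed densely defined symmetric operator. -/
structure IsClosedSymmetric {H : Type*} [NormedAddCommGroup H] [InnerProductSpace ℂ H]
    (S : H →ₗ.[ℂ] H) : Prop where
  dense : Dense (S.domain : Set H)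
  isClosed : S.IsClosed
  symm : S.IsFormalAdjoint S

variable {H : Type*} [NormedAddCommGroup H] [InnerProductSpace ℂ H] [CompleteSpace H]
  {S : H →ₗ.[ℂ] H}

namespace IsClosedSymmetric

theorem exists_shift_add_defect (hS : IsClosedSymmetric S) {ε : ℂ} (hε : ε = I ∨ ε = -I) (x : H) :
    ∃ u v n, (u, v) ∈ S.graph ∧ n ∈ defectSpace S ε ∧ x = v + ε • u + n := by
  have : CompleteSpace (shiftMap S ε).range :=
    (isClosed_range_shiftMap hS.symm hS.isClosed hε).completeSpace_coe
  obtain ⟨_, ⟨⟨⟨u, v⟩, h⟩, rfl⟩, n, hn, rfl⟩ :=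
    (shiftMap S ε).range.exists_add_mem_mem_orthogonal x
  rw [orthogonal_range_shiftMap hS.dense hε] at hn
  exact ⟨u, v, n, h, hn, rfl⟩

theorem exists_shift_of_orthogonal (hS : IsClosedSymmetric S) {ε : ℂ} (hε : ε = I ∨ ε = -I) {x : H}
    (hx : x ∈ (defectSpace S ε)ᗮ) : ∃ u v, (u, v) ∈ S.graph ∧ x = v + ε • u := by
  obtain ⟨u, v, n, h, hn, rfl⟩ := hS.exists_shift_add_defect hε x
  have hn0 : ⟪n, n⟫_ℂ = 0 := by
    have := hx n hn
    rwa [inner_add_right, inner_eq_zero_symm.1 (inner_add_smul_eq_zero hS.dense hε h hn),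
      zero_add] at this
  exact ⟨u, v, h, by rw [inner_self_eq_zero.1 hn0, add_zero]⟩

/-- `u + n` is the preimage of `(S* + i) x` under `S* + i` found in `D(S) + N_i`. -/
theorem exists_vonNeumann (hS : IsClosedSymmetric S) {x y : H} (h : (x, y) ∈ S.adjoint.graph) :
    ∃ u v n m, (u, v) ∈ S.graph ∧ n ∈ defectSpace S I ∧ m ∈ defectSpace S (-I) ∧
      x = u + n + m ∧ y = v + I • n - I • m := by
  obtain ⟨u, v, k, huv, hk, e⟩ := hS.exists_shift_add_defect (.inl rfl) (y + I • x)
  obtain ⟨n, rfl⟩ : ∃ n, k = (2 * I) • n := ⟨(2 * I)⁻¹ • k, by rw [smul_inv_smul₀ (by simp)]⟩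
  have hn : n ∈ defectSpace S I := (Submodule.smul_mem_iff _ (by simp)).1 hk
  have hy : y = v + I • n - I • (x - u - n) := by
    rw [← sub_eq_zero] at e ⊢
    rw [← e]
    module
  have hm := sub_mem_graph (sub_mem_graph h (mem_graph_adjoint_of_mem hS.dense hS.symm huv))
    (mem_defectSpace.1 hn)
  rw [show y - v - I • n = -I • (x - u - n) by rw [hy]; module] at hm
  exact ⟨u, v, n, x - u - n, huv, hn, mem_defectSpace.2 hm, by abel, hy⟩

end IsClosedSymmetric

/-- `T` is the Cayley transform `(S - i)(S + i)⁻¹`, extended by zero to `N_i = ran (S + i)ᗮ`. -/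
structure IsCayley (S : H →ₗ.[ℂ] H) (T : H →L[ℂ] H) : Prop where
  map_shift : ∀ {u v : H}, (u, v) ∈ S.graph → T (v + I • u) = v - I • u
  map_defect : ∀ {n : H}, n ∈ defectSpace S I → T n = 0

theorem IsClosedSymmetric.exists_isCayley (hS : IsClosedSymmetric S) :
    ∃ T : H →L[ℂ] H, IsCayley S T := by
  set R := (shiftMap S I).range
  have : CompleteSpace R :=
    (isClosed_range_shiftMap hS.symm hS.isClosed (.inl rfl)).completeSpace_coe
  let E : S.graph ≃ₗ[ℂ] R := LinearEquiv.ofInjective (shiftMap S I : S.graph →ₗ[ℂ] H)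
    (antilipschitz_shiftMap hS.symm (.inl rfl)).injective
  have hE (y : R) : ‖shiftMap S (-I) (E.symm y)‖ = ‖y‖ := by
    obtain ⟨p, rfl⟩ := E.surjective y
    rw [E.symm_apply_apply]
    exact norm_shiftMap_neg_I hS.symm p
  let V : R →L[ℂ] H := ((shiftMap S (-I) : S.graph →ₗ[ℂ] H) ∘ₗ E.symm.toLinearMap).mkContinuous 1
    fun y => by rw [one_mul]; exact (hE y).le
  refine ⟨V ∘L R.orthogonalProjectionOnto, fun {u v} h => ?_, fun {n} hn => ?_⟩
  · change V (R.orthogonalProjectionOnto (E ⟨(u, v), h⟩ : R)) = _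
    rw [Submodule.orthogonalProjectionOnto_mem_subspace_eq_self]
    change shiftMap S (-I) (E.symm (E ⟨(u, v), h⟩)) = _
    rw [E.symm_apply_apply, shiftMap_apply, neg_smul, sub_eq_add_neg]
  · rw [← orthogonal_range_shiftMap hS.dense (.inl rfl)] at hn
    rw [ContinuousLinearMap.comp_apply,
      Submodule.orthogonalProjectionOnto_eq_zero_iff.2 hn, map_zero]

namespace IsCayley

variable {T : H →L[ℂ] H}

theorem adjoint_map_defect (hT : IsCayley S T) (hS : IsClosedSymmetric S) {m : H}
    (hm : m ∈ defectSpace S (-I)) : adjoint T m = 0 := by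
  refine ext_inner_left ℂ fun z => ?_
  obtain ⟨u, v, n, h, hn, rfl⟩ := hS.exists_shift_add_defect (.inl rfl) z
  have h0 := inner_add_smul_eq_zero hS.dense (.inr rfl) h hm
  rw [neg_smul, ← sub_eq_add_neg] at h0
  rw [ContinuousLinearMap.adjoint_inner_right, inner_zero_right, map_add, hT.map_shift h,
    hT.map_defect hn, add_zero, h0]

theorem adjoint_map_shift (hT : IsCayley S T) (hS : IsClosedSymmetric S) {u v : H}
    (h : (u, v) ∈ S.graph) : adjoint T (v - I • u) = v + I • u := by
  refine ext_inner_left ℂ fun z => ?_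
  obtain ⟨u', v', n, h', hn, rfl⟩ := hS.exists_shift_add_defect (.inl rfl) z
  have h0 := inner_eq_zero_symm.1 (inner_add_smul_eq_zero hS.dense (.inl rfl) h hn)
  rw [ContinuousLinearMap.adjoint_inner_right, map_add, hT.map_shift h', hT.map_defect hn,
    add_zero, inner_sub_I_smul_of_mem_graph hS.symm h' h, inner_add_left (_ + _) n, h0, add_zero]

theorem adjoint_apply_apply (hT : IsCayley S T) (hS : IsClosedSymmetric S) {x : H}
    (hx : x ∈ (defectSpace S I)ᗮ) : adjoint T (T x) = x := by
  obtain ⟨u, v, h, rfl⟩ := hS.exists_shift_of_orthogonal (.inl rfl) hx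
  rw [hT.map_shift h, hT.adjoint_map_shift hS h]

theorem apply_adjoint_apply (hT : IsCayley S T) (hS : IsClosedSymmetric S) {x : H}
    (hx : x ∈ (defectSpace S (-I))ᗮ) : T (adjoint T x) = x := by
  obtain ⟨u, v, h, rfl⟩ := hS.exists_shift_of_orthogonal (.inr rfl) hx
  rw [neg_smul, ← sub_eq_add_neg, hT.adjoint_map_shift hS h, hT.map_shift h]

theorem mapsGraph_of_commute (hT : IsCayley S T) (hS : IsClosedSymmetric S) {R : H →L[ℂ] H}
    (hR : Commute R T) (hR' : Commute R (adjoint T)) : MapsGraph S R := by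
  intro u v h
  have hRT (x : H) : R (T x) = T (R x) := DFunLike.congr_fun hR.eq x
  have hRT' (x : H) : R (adjoint T x) = adjoint T (R x) := DFunLike.congr_fun hR'.eq x
  obtain ⟨u', v', h', e⟩ : ∃ u' v', (u', v') ∈ S.graph ∧ R (v + I • u) = v' + I • u' := by
    refine hS.exists_shift_of_orthogonal (.inl rfl) fun n hn => ?_
    rw [← hT.adjoint_map_shift hS h, hRT', ContinuousLinearMap.adjoint_inner_right,
      hT.map_defect hn, inner_zero_left]
  have e' : R (v - I • u) = v' - I • u' := by
    rw [← hT.map_shift h, hRT, e, hT.map_shift h']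
  simp only [map_add, map_sub, map_smul] at e e'
  have hv : R v = v' := by linear_combination (norm := module) (1 / 2 : ℂ) • e + (1 / 2 : ℂ) • e'
  have hu : I • R u = I • u' := by
    linear_combination (norm := module) (1 / 2 : ℂ) • e - (1 / 2 : ℂ) • e'
  rwa [hv, smul_right_injective H Complex.I_ne_zero hu]

theorem commute_of_mapsGraph (hT : IsCayley S T) (hS : IsClosedSymmetric S) {R : H →L[ℂ] H}
    (hR : MapsGraph S R) (hRn : ∀ n ∈ defectSpace S I, R n ∈ defectSpace S I) : Commute R T := by
  ext x
  obtain ⟨u, v, n, h, hn, rfl⟩ := hS.exists_shift_add_defect (.inl rfl) x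
  rw [mul_apply_eq_comp, mul_apply_eq_comp, map_add T, hT.map_shift h, hT.map_defect hn, add_zero,
    map_add R, map_add T, hT.map_defect (hRn n hn), add_zero, map_add R, map_smul R,
    hT.map_shift (hR h), map_sub, map_smul]

end IsCayley

section Resolvent

open Filter Topology

variable {𝕜 E : Type*} [RCLike 𝕜] [NormedAddCommGroup E] [InnerProductSpace 𝕜 E]
  [CompleteSpace E] (B : E →L[𝕜] E) {y n : E}

/-- The solution `w = (1 - ε B)⁻¹ n` of the resolvent equation tends to `n` as `ε → 0`. -/
theorem inner_eq_zero_of_resolvent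
    (h : ∃ᶠ ε in 𝓝[≠] (0 : 𝕜), ∃ w, w - ε • B w = n ∧ ⟪y, w⟫_𝕜 = 0) : ⟪y, n⟫_𝕜 = 0 := by
  let f : 𝕜 → 𝕜 := fun ε => ⟪y, Ring.inverse (1 - ε • B) n⟫_𝕜
  have h_sub : ContinuousAt (fun ε : 𝕜 => 1 - ε • B) 0 := by fun_prop
  have hf : ContinuousAt f 0 := by
    have h_inv : ContinuousAt Ring.inverse (1 - (0 : 𝕜) • B) := by
      simpa using NormedRing.inverse_continuousAt (1 : (E →L[𝕜] E)ˣ)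
    have h_comp : ContinuousAt (fun ε : 𝕜 => Ring.inverse (1 - ε • B)) 0 :=
      ContinuousAt.comp (f := fun ε : 𝕜 => 1 - ε • B) h_inv h_sub
    fun_prop
  have h_unit : ∀ᶠ ε in 𝓝 (0 : 𝕜), IsUnit (1 - ε • B) :=
    h_sub.eventually_mem (Units.isOpen.mem_nhds (by simp))
  by_contra hne
  have hf0 : f 0 ≠ 0 := by simpa [f] using hne
  obtain ⟨ε, ⟨w, hw, hyw⟩, hu, hε⟩ :=
    (h.and_eventually (nhdsWithin_le_nhds (h_unit.and (hf.eventually_ne hf0)))).exists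
  have hw' : Ring.inverse (1 - ε • B) n = w := by
    rw [← hw]
    exact DFunLike.congr_fun (Ring.inverse_mul_cancel _ hu) w
  exact hε (by rw [← hyw, ← hw'])

/-- If `w` solves the equation for `n`, then `B w` solves it for `B n`. -/
theorem inner_pow_apply_eq_zero_of_resolvent
    (h : ∃ᶠ ε in 𝓝[≠] (0 : 𝕜), ∃ w, w - ε • B w = n ∧ ⟪y, w⟫_𝕜 = 0) (k : ℕ) :
    ⟪y, (B ^ k) n⟫_𝕜 = 0 := by
  induction k generalizing n with
  | zero => exact inner_eq_zero_of_resolvent B h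
  | succ k ih =>
    rw [pow_succ, mul_apply_eq_comp]
    refine ih ((h.and_eventually self_mem_nhdsWithin).mono fun ε ⟨⟨w, hw, hyw⟩, hε⟩ =>
      ⟨B w, by rw [← hw, map_sub, map_smul], ?_⟩)
    have : ε * ⟪y, B w⟫_𝕜 = 0 := by
      rw [← inner_smul_right, ← sub_sub_self w (ε • B w), hw, inner_sub_right, hyw,
        inner_eq_zero_of_resolvent B h, sub_zero]
    exact (mul_eq_zero.1 this).resolve_left hε

end Resolvent

theorem exists_of_mem_graph_dissipativeExt (hS : Dense (S.domain : Set H))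
    (hs : S.IsFormalAdjoint S) {μ : ℂ} {x y : H} (h : (x, y) ∈ (dissipativeExt S μ).graph) :
    ∃ s t m, (s, t) ∈ S.graph ∧ m ∈ defectSpace S μ ∧ x = s + m ∧ y = t + μ • m := by
  obtain ⟨hx, hxy⟩ := mem_graph_domRestrict.1 h
  obtain ⟨s, hs', m, hm, rfl⟩ := Submodule.mem_sup.1 hx
  have hst := S.mem_graph ⟨s, hs'⟩
  exact ⟨s, _, m, hst, hm, rfl, LinearPMap.mem_graph_snd_inj _ hxy
    (add_mem_graph (mem_graph_adjoint_of_mem hS hs hst) (mem_defectSpace.1 hm)) rfl⟩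

theorem im_inner_nonneg_of_mem_graph_dissipativeExt (hS : Dense (S.domain : Set H))
    (hs : S.IsFormalAdjoint S) {μ : ℂ} (hμ : 0 ≤ μ.im) {x y : H}
    (h : (x, y) ∈ (dissipativeExt S μ).graph) : 0 ≤ (⟪x, y⟫_ℂ).im := by
  obtain ⟨s, t, m, hst, hm, rfl, rfl⟩ := exists_of_mem_graph_dissipativeExt hS hs h
  have hmt : ⟪m, t⟫_ℂ = conj (μ * ⟪s, m⟫_ℂ) := by
    rw [← (mem_defectSpace_iff_inner hS).1 hm s t hst, inner_conj_symm]
  have him : (⟪s + m, t + μ • m⟫_ℂ).im = μ.im * ‖m‖ ^ 2 := by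
    rw [inner_add_left, inner_add_right, inner_add_right, inner_smul_right, inner_smul_right, hmt,
      inner_self_eq_norm_sq_to_K, RCLike.ofReal_eq_complex_ofReal, ← Complex.ofReal_pow]
    simp only [Complex.add_im, Complex.conj_im, Complex.im_mul_ofReal,
      im_inner_eq_zero_of_mem_graph hs hst]
    ring
  rw [him]
  positivity

theorem eq_zero_of_mem_graph_dissipativeExt_add_I (hS : Dense (S.domain : Set H))
    (hs : S.IsFormalAdjoint S) {μ : ℂ} (hμ : 0 ≤ μ.im) {x : H}
    (h : (x, (0 : H)) ∈ (subScalar (dissipativeExt S μ) (-I)).graph) : x = 0 := by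
  rw [mem_graph_subScalar, zero_add] at h
  have hx := im_inner_nonneg_of_mem_graph_dissipativeExt hS hs hμ h
  rw [inner_smul_right, inner_self_eq_norm_sq_to_K] at hx
  simpa [← Complex.ofReal_pow] using hx

/-- `n - s ∈ N_μ`, that is, `N_i ⊆ D(S) + N_μ`. -/
theorem exists_of_charFunction_eq_zero (hS : Dense (S.domain : Set H)) (hs : S.IsFormalAdjoint S)
    {μ : ℂ} (hμ : 0 ≤ μ.im)
    (h : charFunction S μ = (0 : H →ₗ[ℂ] H).toPMap (defectSpace S I)) {n : H}
    (hn : n ∈ defectSpace S I) : ∃ s t, (s, t) ∈ S.graph ∧ t - μ • s = (I - μ) • n := by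
  have h0 : (n, (0 : H)) ∈ (charFunction S μ).graph := by
    rw [h]
    exact mem_graph_iff_exists.2 ⟨hn, rfl⟩
  obtain ⟨y, hy, hy'⟩ := mem_graph_opMul.1 (mem_graph_domRestrict.1 h0).2
  rw [mem_graph_inverse fun _ => eq_zero_of_mem_graph_dissipativeExt_add_I hS hs hμ,
    mem_graph_subScalar] at hy
  rw [mem_graph_subScalar, zero_add] at hy'
  have e : n + -I • y = I • y := LinearPMap.mem_graph_snd_inj _ hy hy' rfl
  obtain ⟨s, t, m, hst, -, rfl, hyt⟩ := exists_of_mem_graph_dissipativeExt hS hs hy'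
  refine ⟨(2 * I) • s, (2 * I) • t, smul_mem_graph _ hst, ?_⟩
  rw [eq_sub_of_add_eq e, eq_sub_of_add_eq hyt.symm]
  module

theorem im_I_mul_div_pos {ε : ℂ} (hε : ‖ε‖ < 1) : 0 < (I * ((1 + ε) / (1 - ε))).im := by
  have hre : 0 < (1 - ε).re := by
    have := (Complex.re_le_norm ε).trans_lt hε
    simpa using this
  have hne : 0 < Complex.normSq (1 - ε) := Complex.normSq_pos.2 fun h => by simp [h] at hre
  have hsq : Complex.normSq ε < 1 := by
    rw [Complex.normSq_eq_norm_sq]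
    exact pow_lt_one₀ (norm_nonneg _) hε two_ne_zero
  have h : (I * ((1 + ε) / (1 - ε))).im = (1 - Complex.normSq ε) / Complex.normSq (1 - ε) := by
    rw [Complex.I_mul_im, Complex.div_re, ← add_div, Complex.normSq_apply ε]
    congr 1
    simp
    ring
  rw [h]
  exact div_pos (sub_pos.2 hsq) hne

namespace IsCayley

variable {T : H →L[ℂ] H}

/-- The parameter `ε` corresponds to `μ = i (1 + ε) / (1 - ε)` in the upper half-plane. -/
theorem exists_resolvent_adjoint (hT : IsCayley S T) (hS : IsClosedSymmetric S)
    (hSh : HasZeroCharFunction S) {n m : H} (hn : n ∈ defectSpace S I)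
    (hm : m ∈ defectSpace S (-I)) {ε : ℂ} (hε : ε ≠ 0) (hε' : ‖ε‖ < 1) :
    ∃ w, w - ε • adjoint T w = n ∧ ⟪m, w⟫_ℂ = 0 := by
  have hne : 1 - ε ≠ 0 := by
    rw [sub_ne_zero]
    rintro rfl
    simp at hε'
  set μ := I * ((1 + ε) / (1 - ε)) with hμ
  have him : 0 < μ.im := im_I_mul_div_pos hε'
  obtain ⟨s, t, hst, e⟩ := exists_of_charFunction_eq_zero hS.dense hS.symm him.le (hSh _ him)
    (Submodule.smul_mem _ (I / 2) hn)
  have hw : t - I • s = ε • (t + I • s + n) := by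
    have hμε : (1 - ε) * μ = I * (1 + ε) := by rw [hμ]; field_simp
    have hIμ : (1 - ε) * (I - μ) * (I / 2) = ε := by
      linear_combination -I / 2 * hμε - ε * Complex.I_mul_I
    have := congr((1 - ε) • $e)
    rw [smul_sub, smul_smul, smul_smul, smul_smul, hμε, hIμ] at this
    linear_combination (norm := module) this
  refine ⟨t + I • s + n, ?_, ?_⟩
  · rw [← map_smul, ← hw, hT.adjoint_map_shift hS hst, add_sub_cancel_left]
  · have : ⟪m, T (t + I • s)⟫_ℂ = 0 := by
      rw [← ContinuousLinearMap.adjoint_inner_left, hT.adjoint_map_defect hS hm, inner_zero_left]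
    rw [hT.map_shift hst, hw, inner_smul_right] at this
    exact (mul_eq_zero.1 this).resolve_left hε

open Filter Topology in
theorem inner_pow_adjoint_eq_zero (hT : IsCayley S T) (hS : IsClosedSymmetric S)
    (hSh : HasZeroCharFunction S) {n m : H} (hn : n ∈ defectSpace S I)
    (hm : m ∈ defectSpace S (-I)) (k : ℕ) : ⟪m, (adjoint T ^ k) n⟫_ℂ = 0 := by
  refine inner_pow_apply_eq_zero_of_resolvent _ (Eventually.frequently ?_) k
  have h_ball : ∀ᶠ ε in 𝓝[≠] (0 : ℂ), ‖ε‖ < 1 :=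
    nhdsWithin_le_nhds (continuous_norm.continuousAt.eventually_lt_const (by simp))
  filter_upwards [h_ball, self_mem_nhdsWithin] with ε hε hε0
  exact hT.exists_resolvent_adjoint hS hSh hn hm hε0 hε

end IsCayley

section SelfAdjoint

variable {A : H →ₗ.[ℂ] H}

theorem dense_domain_of_surjective_shiftMap (hA : A.IsFormalAdjoint A)
    (hp : Function.Surjective (shiftMap A I)) (hm : Function.Surjective (shiftMap A (-I))) :
    Dense (A.domain : Set H) := by
  rw [Submodule.dense_iff_topologicalClosure_eq_top, Submodule.topologicalClosure_eq_top_iff,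
    Submodule.eq_bot_iff]
  intro k hk
  obtain ⟨⟨⟨u, v⟩, h⟩, rfl⟩ := hp k
  obtain ⟨⟨⟨u', v'⟩, h'⟩, e⟩ := hm u
  obtain rfl : u = 0 := by
    have h0 := hk u' (mem_graph_iff_exists.1 h').1
    rw [shiftMap_apply, ← inner_shift_eq_of_mem_graph hA h h'] at h0
    rw [← inner_self_eq_zero (𝕜 := ℂ)]
    exact (congrArg (⟪·, u⟫_ℂ) e).symm.trans h0
  rw [shiftMap_apply, smul_zero, add_zero]
  exact LinearPMap.graph_fst_eq_zero_snd _ h rfl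

theorem isSelfAdjoint_of_surjective_shiftMap (hA : A.IsFormalAdjoint A)
    (hp : Function.Surjective (shiftMap A I)) (hm : Function.Surjective (shiftMap A (-I))) :
    IsSelfAdjoint A := by
  have hd := dense_domain_of_surjective_shiftMap hA hp hm
  refine LinearPMap.isSelfAdjoint_def.2
    (graph_ext fun x y => ⟨fun h => ?_, mem_graph_adjoint_of_mem hd hA⟩)
  obtain ⟨⟨⟨u, v⟩, huv⟩, e⟩ := hp (y + I • x)
  obtain ⟨⟨⟨u', v'⟩, huv'⟩, e'⟩ := hm (x - u)
  have hxu : (x - u, -I • (x - u)) ∈ A.adjoint.graph := by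
    have : y - v = -I • (x - u) := by
      linear_combination (norm := module) -((shiftMap_apply A I _).symm.trans e)
    exact this ▸ sub_mem_graph h (mem_graph_adjoint_of_mem hd hA huv)
  obtain rfl : x = u := by
    have h0 := inner_add_smul_eq_zero hd (.inr rfl) huv' (mem_defectSpace.2 hxu)
    rw [← sub_eq_zero, ← inner_self_eq_zero (𝕜 := ℂ)]
    exact (congrArg (⟪·, x - u⟫_ℂ) e').symm.trans h0
  rwa [add_right_cancel e.symm]

end SelfAdjoint

theorem mem_of_add_I_smul_mem {V : Type*} [AddCommGroup V] [Module ℂ V] {K : Submodule ℂ V}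
    {u v : V} (h : v + I • u ∈ K) (h' : v - I • u ∈ K) :
    u ∈ K ∧ v ∈ K := by
  have hu : (2 * I) • u ∈ K := by
    rw [show (2 * I) • u = v + I • u - (v - I • u) by module]
    exact sub_mem h h'
  have hu := (Submodule.smul_mem_iff K (by simp)).1 hu
  exact ⟨hu, (add_mem_cancel_right (Submodule.smul_mem K I hu)).1 h⟩

section Simple

variable {T : H →L[ℂ] H} {K : Submodule ℂ H}

theorem IsCayley.surjective_shiftMap_part (hT : IsCayley S T) (hS : IsClosedSymmetric S)
    (hK : K ≤ (defectSpace S I)ᗮ) (hKT : ∀ x ∈ K, T x ∈ K) :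
    Function.Surjective (shiftMap (part S K) I) := by
  rintro ⟨x, hx⟩
  obtain ⟨u, v, h, rfl⟩ := hS.exists_shift_of_orthogonal (.inl rfl) (hK hx)
  obtain ⟨hu, hv⟩ := mem_of_add_I_smul_mem hx (hT.map_shift h ▸ hKT _ hx)
  exact ⟨⟨(⟨u, hu⟩, ⟨v, hv⟩), mem_graph_part.2 h⟩, rfl⟩

theorem IsCayley.surjective_shiftMap_part_neg (hT : IsCayley S T) (hS : IsClosedSymmetric S)
    (hK : K ≤ (defectSpace S (-I))ᗮ) (hKT : ∀ x ∈ K, adjoint T x ∈ K) :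
    Function.Surjective (shiftMap (part S K) (-I)) := by
  rintro ⟨x, hx⟩
  obtain ⟨u, v, h, rfl⟩ := hS.exists_shift_of_orthogonal (.inr rfl) (hK hx)
  have hx' : v - I • u ∈ K := by rwa [sub_eq_add_neg, ← neg_smul]
  obtain ⟨hu, hv⟩ := mem_of_add_I_smul_mem (hT.adjoint_map_shift hS h ▸ hKT _ hx') hx'
  exact ⟨⟨(⟨u, hu⟩, ⟨v, hv⟩), mem_graph_part.2 h⟩, rfl⟩

theorem IsCayley.eq_bot_of_isSimple [CompleteSpace K] (hT : IsCayley S T)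
    (hS : IsClosedSymmetric S) (hsimple : IsSimple S) (hK : K ≤ (defectSpace S I)ᗮ)
    (hK' : K ≤ (defectSpace S (-I))ᗮ) (hKT : ∀ x ∈ K, T x ∈ K)
    (hKT' : ∀ x ∈ K, adjoint T x ∈ K) : K = ⊥ :=
  hsimple K (isSelfAdjoint_of_surjective_shiftMap
    (fun x y => inner_eq_of_mem_graph hS.symm (mem_graph_part.1 ((part S K).mem_graph x))
      (mem_graph_part.1 ((part S K).mem_graph y)))
    (hT.surjective_shiftMap_part hS hK hKT) (hT.surjective_shiftMap_part_neg hS hK' hKT'))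

end Simple

section Part

variable {K : Submodule ℂ H}

omit [CompleteSpace H] in
theorem dense_domain_part [K.HasOrthogonalProjection] (hS : Dense (S.domain : Set H))
    (hK : MapsGraph S K.starProjection) : Dense ((part S K).domain : Set K) := by
  have h_surj : Function.Surjective K.orthogonalProjectionOnto :=
    fun x => ⟨x, K.orthogonalProjectionOnto_mem_subspace_eq_self x⟩
  refine (h_surj.denseRange.dense_image K.orthogonalProjectionOnto.continuous hS).mono ?_
  rintro _ ⟨u, hu, rfl⟩
  have h : (K.orthogonalProjectionOnto u, K.orthogonalProjectionOnto (S ⟨u, hu⟩)) ∈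
      (part S K).graph := mem_graph_part.2 (hK (S.mem_graph ⟨u, hu⟩))
  exact (mem_graph_iff_exists.1 h).1

theorem mem_defectSpace_part [CompleteSpace K] (hS : Dense (S.domain : Set H))
    (hK : MapsGraph S K.starProjection) {μ : ℂ} {x : K} :
    x ∈ defectSpace (part S K) μ ↔ (x : H) ∈ defectSpace S μ := by
  have h_inner (u : H) : ⟪K.starProjection u, x⟫_ℂ = ⟪u, x⟫_ℂ := by
    rw [K.inner_starProjection_left_eq_right, K.starProjection_mem_subspace_eq_self]
  have hd := dense_domain_part hS hK
  rw [mem_defectSpace_iff_inner hd, mem_defectSpace_iff_inner hS]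
  simp only [Submodule.coe_inner]
  constructor
  · intro h u v huv
    have hP : (K.orthogonalProjectionOnto u, K.orthogonalProjectionOnto v) ∈ (part S K).graph :=
      mem_graph_part.2 (hK huv)
    rw [← h_inner u, ← h_inner v]
    exact h _ _ hP
  · exact fun h u v huv => h (u : H) (v : H) (mem_graph_part.1 huv)

end Part

namespace FundamentalSymmetry

variable (J : FundamentalSymmetry H)

theorem inner_op_left (x y : H) : ⟪J.op x, y⟫_ℂ = ⟪x, J.op y⟫_ℂ := by
  rw [← ContinuousLinearMap.adjoint_inner_right, J.isSelfAdjoint.adjoint_eq]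

theorem inner_eq_zero {x y : H} (hx : J.op x = x) (hy : J.op y = -y) : ⟪x, y⟫_ℂ = 0 := by
  have h := J.inner_op_left x y
  rw [hx, hy, inner_neg_right] at h
  exact self_eq_neg.1 h

theorem starProjection_plus : J.plus.starProjection = (1 / 2 : ℂ) • (1 + J.op) := by
  ext x
  refine Submodule.eq_starProjection_of_mem_of_inner_eq_zero ⟨x, rfl⟩ fun y hy =>
    inner_eq_zero_symm.1 (J.inner_eq_zero ((J.mem_plus y).1 hy) ?_)
  simp only [map_sub, smul_apply, add_apply, one_apply_eq_self, map_smul, map_add, J.op_op]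
  module

theorem starProjection_minus : J.minus.starProjection = (1 / 2 : ℂ) • (1 - J.op) := by
  ext x
  refine Submodule.eq_starProjection_of_mem_of_inner_eq_zero ⟨x, rfl⟩ fun y hy =>
    J.inner_eq_zero ?_ ((J.mem_minus y).1 hy)
  simp only [map_sub, smul_apply, sub_apply, one_apply_eq_self, map_smul, J.op_op]
  module

variable {J}

theorem mapsGraph_starProjection_plus (hJ : MapsGraph S J.op) :
    MapsGraph S J.plus.starProjection := by
  rw [starProjection_plus]
  exact fun _ _ h => smul_mem_graph _ (add_mem_graph h (hJ h))

theorem mapsGraph_starProjection_minus (hJ : MapsGraph S J.op) :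
    MapsGraph S J.minus.starProjection := by
  rw [starProjection_minus]
  exact fun _ _ h => smul_mem_graph _ (sub_mem_graph h (hJ h))

theorem mapsGraph_adjoint (hS : Dense (S.domain : Set H)) (hJ : MapsGraph S J.op) :
    MapsGraph S.adjoint J.op :=
  MapsGraph.adjoint hS (by rwa [J.isSelfAdjoint.adjoint_eq])

theorem defectSpace_eq_span_pair (hS : Dense (S.domain : Set H)) (hJ : MapsGraph S J.op) {μ : ℂ}
    {a : J.plus} {b : J.minus} (ha : Submodule.span ℂ {a} = defectSpace (part S J.plus) μ)
    (hb : Submodule.span ℂ {b} = defectSpace (part S J.minus) μ) :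
    defectSpace S μ = Submodule.span ℂ {(a : H), (b : H)} := by
  have hp {x : J.plus} : x ∈ Submodule.span ℂ {a} ↔ (x : H) ∈ defectSpace S μ := by
    rw [ha, mem_defectSpace_part hS (mapsGraph_starProjection_plus hJ)]
  have hm {x : J.minus} : x ∈ Submodule.span ℂ {b} ↔ (x : H) ∈ defectSpace S μ := by
    rw [hb, mem_defectSpace_part hS (mapsGraph_starProjection_minus hJ)]
  apply le_antisymm
  · intro x hx
    have hJx := (mapsGraph_adjoint hS hJ).apply_mem_defectSpace hx
    obtain ⟨c, hc⟩ := Submodule.mem_span_singleton.1 (hp (x := ⟨(1 / 2 : ℂ) • (x + J.op x), x, rfl⟩)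
      |>.2 (Submodule.smul_mem _ _ (add_mem hx hJx)))
    obtain ⟨d, hd⟩ := Submodule.mem_span_singleton.1 (hm (x := ⟨(1 / 2 : ℂ) • (x - J.op x), x, rfl⟩)
      |>.2 (Submodule.smul_mem _ _ (sub_mem hx hJx)))
    have hc : c • (a : H) = (1 / 2 : ℂ) • (x + J.op x) := congrArg Subtype.val hc
    have hd : d • (b : H) = (1 / 2 : ℂ) • (x - J.op x) := congrArg Subtype.val hd
    exact Submodule.mem_span_pair.2 ⟨c, d, by rw [hc, hd]; module⟩
  · rw [Submodule.span_le]
    rintro _ (rfl | rfl)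
    · exact hp.1 (Submodule.mem_span_singleton_self a)
    · exact hm.1 (Submodule.mem_span_singleton_self b)

end FundamentalSymmetry

theorem exists_norm_eq_one_span_eq {E : Type*} [NormedAddCommGroup E] [NormedSpace ℂ E]
    {N : Submodule ℂ E} (h : Module.finrank ℂ N = 1) :
    ∃ x : E, ‖x‖ = 1 ∧ Submodule.span ℂ {x} = N := by
  have hN : N ≠ ⊥ := by
    rintro rfl
    simp at h
  obtain ⟨v, hv, hv0⟩ := N.exists_mem_ne_zero_of_ne_bot hN
  have hc : ((‖v‖ : ℂ)⁻¹) ≠ 0 := inv_ne_zero (Complex.ofReal_ne_zero.2 (norm_ne_zero_iff.2 hv0))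
  refine ⟨(‖v‖ : ℂ)⁻¹ • v, norm_smul_inv_norm (𝕜 := ℂ) hv0, ?_⟩
  rw [Submodule.span_singleton_smul_eq hc.isUnit]
  have : FiniteDimensional ℂ N := Module.finite_of_finrank_eq_succ h
  exact Submodule.eq_of_le_of_finrank_eq ((Submodule.span_singleton_le_iff_mem _ _).2 hv)
    (by rw [finrank_span_singleton hv0, h])

namespace DefectBasis

variable {J : FundamentalSymmetry H}

theorem nonempty (hp : HasDeficiencyIndicesOne (part S J.plus))
    (hm : HasDeficiencyIndicesOne (part S J.minus)) : Nonempty (DefectBasis J S) := by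
  obtain ⟨a, ha, ha'⟩ := exists_norm_eq_one_span_eq hp.1
  obtain ⟨b, hb, hb'⟩ := exists_norm_eq_one_span_eq hp.2
  obtain ⟨c, hc, hc'⟩ := exists_norm_eq_one_span_eq hm.1
  obtain ⟨d, hd, hd'⟩ := exists_norm_eq_one_span_eq hm.2
  exact ⟨⟨a, c, b, d, ha', hc', hb', hd', by rw [hc, ha], by rw [hb, ha], by rw [hd, ha]⟩⟩

theorem epp_ne_zero (e : DefectBasis J S) (hp : HasDeficiencyIndicesOne (part S J.plus)) :
    e.epp ≠ 0 := by
  intro h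
  have h1 := hp.1
  rw [← e.span_epp, h, Submodule.span_zero_singleton, finrank_bot] at h1
  exact zero_ne_one h1

end DefectBasis

section KreinAdjoint

variable {J : FundamentalSymmetry H} {A : H →ₗ.[ℂ] H}

theorem mem_graph_kreinAdjoint {x y : H} :
    (x, y) ∈ (kreinAdjoint J A).graph ↔ (J.op x, J.op y) ∈ A.adjoint.graph := by
  simp only [kreinAdjoint, mem_graph_opMul, mem_graph_everywhere, ContinuousLinearMap.coe_coe]
  constructor
  · rintro ⟨_, ⟨_, rfl, h⟩, rfl⟩
    rwa [J.op_op]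
  · exact fun h => ⟨J.op y, ⟨J.op x, rfl, h⟩, J.op_op y⟩

theorem mem_graph_kreinAdjoint_iff_inner (hA : Dense (A.domain : Set H)) {x y : H} :
    (x, y) ∈ (kreinAdjoint J A).graph ↔
      ∀ u v, (u, v) ∈ A.graph → ⟪J.op v, x⟫_ℂ = ⟪J.op u, y⟫_ℂ := by
  simp only [mem_graph_kreinAdjoint, mem_graph_adjoint hA, J.inner_op_left]

theorem kreinAdjoint_le_adjoint (hS : Dense (S.domain : Set H)) (hJ : MapsGraph S J.op)
    (hSA : S ≤ A) : kreinAdjoint J A ≤ S.adjoint := by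
  refine LinearPMap.le_of_le_graph fun ⟨x, y⟩ h => ?_
  rw [mem_graph_kreinAdjoint_iff_inner (hS.mono hSA.1)] at h
  rw [mem_graph_adjoint hS]
  intro u v huv
  simpa only [J.op_op] using h _ _ (LinearPMap.le_graph_of_le hSA (hJ huv))

theorem SigmaJ.le_adjoint (hS : Dense (S.domain : Set H)) (hJ : MapsGraph S J.op)
    (hA : A ∈ SigmaJ J S) : A ≤ S.adjoint := by
  rw [← hA.2.2]
  exact kreinAdjoint_le_adjoint hS hJ hA.1

theorem SigmaJ.inner_op_eq (hA : A ∈ SigmaJ J S) {u v x y : H} (h : (u, v) ∈ A.graph)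
    (h' : (x, y) ∈ A.graph) : ⟪J.op v, x⟫_ℂ = ⟪J.op u, y⟫_ℂ := by
  rw [← hA.2.2] at h'
  exact (mem_graph_kreinAdjoint_iff_inner hA.2.1).1 h' u v h

theorem op_mem_CSymmetries (hSJ : Commutes S J.op) : J.op ∈ CSymmetries J S := by
  refine ⟨J.sq_eq_one, ⟨by rw [J.sq_eq_one]; exact .one _, fun x hx => ?_⟩, hSJ⟩
  rw [J.sq_eq_one, one_apply_eq_self]
  exact (re_inner_self_pos (𝕜 := ℂ)).2 hx

theorem UpsilonJ_subset_SigmaJst (hSJ : Commutes S J.op) : UpsilonJ J S ⊆ SigmaJst J S :=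
  fun _ hA => ⟨hA.1, J.op, op_mem_CSymmetries hSJ, hA.2⟩

theorem UpsilonU_subset_UpsilonJ (hSJ : Commutes S J.op) : UpsilonU J S ⊆ UpsilonJ J S :=
  fun _ hA => ⟨hA.1, hA.2 _ (op_mem_CSymmetries hSJ)⟩

end KreinAdjoint

/-- The signs of `± i` in the deficiency spaces `N_{± i}`. -/
def sgn : Fin 2 → ℂ := ![1, -1]

theorem sgn_mul_sgn : sgn * sgn = 1 := by
  ext k
  fin_cases k <;> simp [sgn]

namespace DefectBasis

variable {J : FundamentalSymmetry H} (e : DefectBasis J S)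

/-- The vectors of a defect basis: `vec s 0 ∈ N_i` and `vec s 1 ∈ N_{-i}`, and the two vectors
`vec true k` are those which have coefficients `0` and `1` in the `d₁`, `d₂` spanning `M_U`. -/
def vec : Bool → Fin 2 → H
  | true => ![e.epp, e.emm]
  | false => ![e.epm, e.emp]

/-- The element of `N_i + N_{-i}` with coordinates `w` in `e₊₊, e₋₋` and `z` in `e₊₋, e₋₊`, so that
`M_U` is the graph `z = w U`. -/
def comb (w z : Fin 2 → ℂ) : H :=
  ∑ k, (w k • e.vec true k + z k • e.vec false k)

theorem comb_eq (w z : Fin 2 → ℂ) : e.comb w z =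
    w 0 • (e.epp : H) + z 0 • (e.epm : H) + (w 1 • (e.emm : H) + z 1 • (e.emp : H)) :=
  Fin.sum_univ_two _

theorem comb_smul (c : ℂ) (w z : Fin 2 → ℂ) : e.comb (c • w) (c • z) = c • e.comb w z := by
  simp only [comb_eq, Pi.smul_apply, smul_eq_mul]
  module

theorem comb_sub (w z w' z' : Fin 2 → ℂ) :
    e.comb (w - w') (z - z') = e.comb w z - e.comb w' z' := by
  simp only [comb_eq, Pi.sub_apply]
  module

theorem op_vec_true (k : Fin 2) : J.op (e.vec true k) = sgn k • e.vec true k := by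
  fin_cases k
  · simpa [vec, sgn] using (J.mem_plus _).1 e.epp.2
  · simpa [vec, sgn] using (J.mem_minus _).1 e.emm.2

theorem op_vec_false (k : Fin 2) : J.op (e.vec false k) = -sgn k • e.vec false k := by
  fin_cases k
  · simpa [vec, sgn] using (J.mem_minus _).1 e.epm.2
  · simpa [vec, sgn] using (J.mem_plus _).1 e.emp.2

theorem op_comb (w z : Fin 2 → ℂ) : J.op (e.comb w z) = e.comb (sgn * w) (-(sgn * z)) := by
  simp only [comb, map_sum, map_add, map_smul, op_vec_true, op_vec_false, Pi.mul_apply,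
    Pi.neg_apply]
  refine Finset.sum_congr rfl fun k _ => ?_
  module

theorem norm_vec (s : Bool) (k : Fin 2) : ‖e.vec s k‖ = ‖e.epp‖ := by
  cases s <;> fin_cases k
  exacts [e.norm_epm, e.norm_emp, rfl, e.norm_emm]

theorem inner_vec (s t : Bool) (k : Fin 2) :
    ⟪e.vec s k, e.vec t k⟫_ℂ = if s = t then (‖e.epp‖ : ℂ) ^ 2 else 0 := by
  have hpm : ⟪(e.epp : H), e.epm⟫_ℂ = 0 :=
    J.inner_eq_zero ((J.mem_plus _).1 e.epp.2) ((J.mem_minus _).1 e.epm.2)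
  have hmp : ⟪(e.emp : H), e.emm⟫_ℂ = 0 :=
    J.inner_eq_zero ((J.mem_plus _).1 e.emp.2) ((J.mem_minus _).1 e.emm.2)
  split_ifs with h
  · rw [h, inner_self_eq_norm_sq_to_K, e.norm_vec]
    rfl
  · cases s <;> cases t <;> fin_cases k <;> first | exact absurd rfl h | skip
    exacts [inner_eq_zero_symm.1 hpm, hmp, hpm, inner_eq_zero_symm.1 hmp]

theorem inner_comb_add_inner_comb_sgn (a b a' b' : Fin 2 → ℂ) :
    ⟪e.comb a b, e.comb a' b'⟫_ℂ + ⟪e.comb (sgn * a) (sgn * b), e.comb (sgn * a') (sgn * b')⟫_ℂ =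
      2 * ‖e.epp‖ ^ 2 * (star a ⬝ᵥ a' + star b ⬝ᵥ b') := by
  simp only [comb, Fin.sum_univ_two, inner_add_left, inner_add_right, inner_smul_left,
    inner_smul_right, inner_vec, Pi.mul_apply, sgn, Matrix.cons_val_zero, Matrix.cons_val_one,
    dotProduct, Pi.star_apply, RCLike.star_def, map_mul, map_neg, map_one, if_true,
    Bool.false_eq_true, Bool.true_eq_false, if_false]
  ring

variable (hS : Dense (S.domain : Set H)) (hJ : MapsGraph S J.op)

include hS hJ

theorem defectSpace_I : defectSpace S I = Submodule.span ℂ {(e.epp : H), (e.epm : H)} :=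
  FundamentalSymmetry.defectSpace_eq_span_pair hS hJ e.span_epp e.span_epm

theorem defectSpace_neg_I : defectSpace S (-I) = Submodule.span ℂ {(e.emp : H), (e.emm : H)} :=
  FundamentalSymmetry.defectSpace_eq_span_pair hS hJ e.span_emp e.span_emm

theorem vec_mem_defectSpace (s : Bool) (k : Fin 2) :
    e.vec s k ∈ defectSpace S (I * sgn k) := by
  fin_cases k
  · simp only [sgn, Fin.zero_eta, Matrix.cons_val_zero, mul_one, e.defectSpace_I hS hJ]
    cases s <;> exact Submodule.subset_span (by simp [vec])
  · simp only [sgn, Fin.mk_one, Matrix.cons_val_one, Matrix.cons_val_zero, mul_neg_one,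
      e.defectSpace_neg_I hS hJ]
    cases s <;> exact Submodule.subset_span (by simp [vec])

theorem comb_mem_graph_adjoint (w z : Fin 2 → ℂ) :
    (e.comb w z, I • e.comb (sgn * w) (sgn * z)) ∈ S.adjoint.graph := by
  have h (s k) := mem_defectSpace.1 (e.vec_mem_defectSpace hS hJ s k)
  have hsum := sum_mem (t := Finset.univ) fun k _ =>
    add_mem_graph (smul_mem_graph (w k) (h true k)) (smul_mem_graph (z k) (h false k))
  rw [← prod_mk_sum] at hsum
  have hsnd : I • e.comb (sgn * w) (sgn * z) =
      ∑ k, (w k • (I * sgn k) • e.vec true k + z k • (I * sgn k) • e.vec false k) := by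
    simp only [comb, Finset.smul_sum, Pi.mul_apply]
    refine Finset.sum_congr rfl fun k _ => ?_
    module
  rwa [hsnd]

end DefectBasis

namespace DefectBasis

variable {J : FundamentalSymmetry H} (e : DefectBasis J S) (hS : IsClosedSymmetric S)
  (hJ : MapsGraph S J.op)

include hS hJ

theorem exists_comb_of_mem_graph_adjoint {x y : H} (h : (x, y) ∈ S.adjoint.graph) :
    ∃ u v w z, (u, v) ∈ S.graph ∧ x = u + e.comb w z ∧ y = v + I • e.comb (sgn * w) (sgn * z) := by
  obtain ⟨u, v, n, m, huv, hn, hm, rfl, -⟩ := hS.exists_vonNeumann h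
  rw [e.defectSpace_I hS.dense hJ, Submodule.mem_span_pair] at hn
  rw [e.defectSpace_neg_I hS.dense hJ, Submodule.mem_span_pair] at hm
  obtain ⟨a, b, rfl⟩ := hn
  obtain ⟨c, d, rfl⟩ := hm
  have hx : u + (a • (e.epp : H) + b • (e.epm : H)) + (c • (e.emp : H) + d • (e.emm : H)) =
      u + e.comb ![a, d] ![b, c] := by
    simp only [comb_eq, Matrix.cons_val_zero, Matrix.cons_val_one]
    abel
  refine ⟨u, v, ![a, d], ![b, c], huv, hx, LinearPMap.mem_graph_snd_inj _ h ?_ hx⟩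
  exact add_mem_graph (mem_graph_adjoint_of_mem hS.dense hS.symm huv)
    (e.comb_mem_graph_adjoint hS.dense hJ _ _)

theorem boundaryForm {u v u' v' : H} (huv : (u, v) ∈ S.graph) (huv' : (u', v') ∈ S.graph)
    (w z w' z' : Fin 2 → ℂ) :
    ⟪J.op (v + I • e.comb (sgn * w) (sgn * z)), u' + e.comb w' z'⟫_ℂ -
        ⟪J.op (u + e.comb w z), v' + I • e.comb (sgn * w') (sgn * z')⟫_ℂ =
      -(2 * I * ‖e.epp‖ ^ 2) * (star w ⬝ᵥ w' - star z ⬝ᵥ z') := by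
  have hadj {u v : H} (h : (u, v) ∈ S.graph) := mem_graph_adjoint_of_mem hS.dense hS.symm h
  have hcomb (w z) := e.comb_mem_graph_adjoint hS.dense hJ w z
  have hS' := (mem_graph_adjoint hS.dense).1
    (add_mem_graph (hadj huv') (hcomb w' z')) _ _ (hJ huv)
  have hcomb' := (mem_graph_adjoint hS.dense).1 (hcomb w z) _ _ (hJ huv')
  rw [J.inner_op_left, J.inner_op_left, ← inner_conj_symm v', ← inner_conj_symm u'] at hcomb'
  have hcomb' := (starRingEnd ℂ).injective hcomb'
  have hform := e.inner_comb_add_inner_comb_sgn w (-z) w' z'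
  have hop : J.op (I • e.comb (sgn * w) (sgn * z)) = I • e.comb w (-z) := by
    rw [map_smul, op_comb, ← mul_assoc, ← mul_assoc, sgn_mul_sgn, one_mul, one_mul]
  simp only [map_add, hop, inner_add_left, inner_add_right, op_comb, inner_smul_left,
    inner_smul_right, Complex.conj_I, mul_neg, star_neg, neg_dotProduct] at hform hS' hcomb' ⊢
  linear_combination hS' - hcomb' - I * hform

open scoped ComplexOrder in
theorem eq_zero_of_comb_mem_domain (he : e.epp ≠ 0) {w z : Fin 2 → ℂ}
    (h : e.comb w z ∈ S.domain) : w = 0 ∧ z = 0 := by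
  have hc : (2 * I * (‖e.epp‖ : ℂ) ^ 2) ≠ 0 := by simp [he]
  obtain ⟨v, hv⟩ := LinearPMap.mem_domain_iff.1 h
  have hadj := mem_graph_adjoint_of_mem hS.dense hS.symm hv
  have hcomb (w z) := e.comb_mem_graph_adjoint hS.dense hJ w z
  obtain rfl := LinearPMap.mem_graph_snd_inj _ hadj (hcomb w z) rfl
  have hform (w' z') : star w ⬝ᵥ w' = star z ⬝ᵥ z' := by
    have h0 := e.boundaryForm hS hJ S.graph.zero_mem S.graph.zero_mem w z w' z'
    rw [zero_add, zero_add, zero_add, zero_add,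
      (mem_graph_adjoint hS.dense).1 (hcomb w' z') _ _ (hJ hv), sub_self] at h0
    exact sub_eq_zero.1 ((mul_eq_zero.1 h0.symm).resolve_left (neg_ne_zero.2 hc))
  exact ⟨dotProduct_star_self_eq_zero.1 <| (hform w 0).trans (dotProduct_zero _),
    dotProduct_star_self_eq_zero.1 <| (hform 0 z).symm.trans <| by simp⟩

end DefectBasis

theorem eq_vecMul_iff {n : Type*} [Fintype n] [DecidableEq n] {U : Matrix n n ℂ}
    (hU : U ∈ Matrix.unitaryGroup n ℂ) {w z : n → ℂ} :
    z = w ᵥ* U ↔ ∀ w', star w' ⬝ᵥ w = star (w' ᵥ* U) ⬝ᵥ z := by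
  have hiff : z = w ᵥ* U ↔ w = z ᵥ* star U := by
    constructor <;> rintro rfl
    · rw [Matrix.vecMul_vecMul, Matrix.mem_unitaryGroup_iff.1 hU, Matrix.vecMul_one]
    · rw [Matrix.vecMul_vecMul, Matrix.mem_unitaryGroup_iff'.1 hU, Matrix.vecMul_one]
  have hdot (w') : star (w' ᵥ* U) ⬝ᵥ z = star w' ⬝ᵥ (z ᵥ* star U) := by
    rw [Matrix.star_vecMul, dotProduct_comm, Matrix.dotProduct_mulVec, dotProduct_comm,
      Matrix.star_eq_conjTranspose]
  simp only [hiff, hdot]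
  refine ⟨fun h w' => by rw [← h], fun h => dotProduct_eq _ _ fun v => ?_⟩
  simpa only [star_star, dotProduct_comm v] using h (star v)

section ExtOfMatrix

variable {J : FundamentalSymmetry H} {e : DefectBasis J S} {U : Matrix (Fin 2) (Fin 2) ℂ}

theorem mem_neutralSpace {x : H} :
    x ∈ neutralSpace e U ↔ ∃ w : Fin 2 → ℂ, x = e.comb w (w ᵥ* U) := by
  have h (p q : ℂ) : p • ((e.epp : H) + U 0 0 • (e.epm : H) + U 0 1 • (e.emp : H)) +
      q • ((e.emm : H) + U 1 0 • (e.epm : H) + U 1 1 • (e.emp : H)) =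
      e.comb ![p, q] (![p, q] ᵥ* U) := by
    simp only [DefectBasis.comb_eq, Matrix.vecMul, dotProduct, Fin.sum_univ_two,
      Matrix.cons_val_zero, Matrix.cons_val_one]
    module
  simp only [neutralSpace, Submodule.mem_span_pair, h]
  constructor
  · rintro ⟨p, q, rfl⟩
    exact ⟨_, rfl⟩
  · rintro ⟨w, rfl⟩
    refine ⟨w 0, w 1, ?_⟩
    rw [← FinVec.etaExpand_eq w]
    rfl

variable (hS : IsClosedSymmetric S) (hJ : MapsGraph S J.op)

include hS hJ

theorem mem_graph_extOfMatrix {x y : H} :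
    (x, y) ∈ (extOfMatrix e U).graph ↔ ∃ u v w, (u, v) ∈ S.graph ∧
      x = u + e.comb w (w ᵥ* U) ∧ y = v + I • e.comb (sgn * w) (sgn * (w ᵥ* U)) := by
  have hadj {u v} (w) (h : (u, v) ∈ S.graph) := add_mem_graph
    (mem_graph_adjoint_of_mem hS.dense hS.symm h) (e.comb_mem_graph_adjoint hS.dense hJ w (w ᵥ* U))
  rw [extOfMatrix, mem_graph_domRestrict, Submodule.mem_sup]
  constructor
  · rintro ⟨⟨u, hu, m, hm, rfl⟩, hy⟩
    obtain ⟨w, rfl⟩ := mem_neutralSpace.1 hm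
    obtain ⟨v, huv⟩ := LinearPMap.mem_domain_iff.1 hu
    exact ⟨u, v, w, huv, rfl, LinearPMap.mem_graph_snd_inj _ hy (hadj w huv) rfl⟩
  · rintro ⟨u, v, w, huv, rfl, rfl⟩
    exact ⟨⟨u, LinearPMap.mem_domain_of_mem_graph huv, _, mem_neutralSpace.2 ⟨w, rfl⟩, rfl⟩,
      hadj w huv⟩

theorem comb_mem_graph_extOfMatrix (w : Fin 2 → ℂ) :
    (e.comb w (w ᵥ* U), I • e.comb (sgn * w) (sgn * (w ᵥ* U))) ∈ (extOfMatrix e U).graph :=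
  (mem_graph_extOfMatrix hS hJ).2
    ⟨0, 0, w, S.graph.zero_mem, (zero_add _).symm, (zero_add _).symm⟩

theorem le_extOfMatrix : S ≤ extOfMatrix e U := by
  refine LinearPMap.le_of_le_graph fun ⟨u, v⟩ h => ?_
  refine (mem_graph_extOfMatrix hS hJ).2 ⟨u, v, 0, h, ?_, ?_⟩ <;>
    simp [DefectBasis.comb]

theorem extOfMatrix_mem_SigmaJ (he : e.epp ≠ 0) (hU : U ∈ Matrix.unitaryGroup (Fin 2) ℂ) :
    extOfMatrix e U ∈ SigmaJ J S := by
  have hle := le_extOfMatrix (e := e) (U := U) hS hJ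
  have hA := hS.dense.mono hle.1
  have hc : (2 * I * (‖e.epp‖ : ℂ) ^ 2) ≠ 0 := by simp [he]
  have hform {u v u' v' : H} (h : (u, v) ∈ S.graph) (h' : (u', v') ∈ S.graph) (w w' z') :
      ⟪J.op (v + I • e.comb (sgn * w) (sgn * (w ᵥ* U))), u' + e.comb w' z'⟫_ℂ =
          ⟪J.op (u + e.comb w (w ᵥ* U)), v' + I • e.comb (sgn * w') (sgn * z')⟫_ℂ ↔
        star w ⬝ᵥ w' = star (w ᵥ* U) ⬝ᵥ z' := by
    rw [← sub_eq_zero, e.boundaryForm hS hJ h h', mul_eq_zero, neg_eq_zero, sub_eq_zero]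
    exact or_iff_right hc
  refine ⟨hle, hA, graph_ext fun x y => ⟨fun h => ?_, fun h => ?_⟩⟩
  · obtain ⟨u, v, w, z, huv, rfl, rfl⟩ := e.exists_comb_of_mem_graph_adjoint hS hJ
      (LinearPMap.le_graph_of_le (kreinAdjoint_le_adjoint hS.dense hJ hle) h)
    rw [mem_graph_kreinAdjoint_iff_inner hA] at h
    obtain rfl : z = w ᵥ* U := (eq_vecMul_iff hU).2 fun w' =>
      (hform S.graph.zero_mem huv w' w z).1 <| by
        simpa only [zero_add] using h _ _ (comb_mem_graph_extOfMatrix hS hJ w')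
    exact (mem_graph_extOfMatrix hS hJ).2 ⟨u, v, w, huv, rfl, rfl⟩
  · rw [mem_graph_kreinAdjoint_iff_inner hA]
    intro p q hpq
    obtain ⟨u, v, w, huv, rfl, rfl⟩ := (mem_graph_extOfMatrix hS hJ).1 h
    obtain ⟨u', v', w', huv', rfl, rfl⟩ := (mem_graph_extOfMatrix hS hJ).1 hpq
    exact (hform huv' huv w' w _).2 ((eq_vecMul_iff hU).1 rfl w')

theorem eq_vecMul_of_comb_mem_domain (he : e.epp ≠ 0) {w z : Fin 2 → ℂ}
    (h : e.comb w z ∈ (extOfMatrix e U).domain) : z = w ᵥ* U := by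
  obtain ⟨y, hy⟩ := LinearPMap.mem_domain_iff.1 h
  obtain ⟨u, v, w', huv, hx, -⟩ := (mem_graph_extOfMatrix hS hJ).1 hy
  have hu : e.comb (w - w') (z - w' ᵥ* U) ∈ S.domain := by
    rw [e.comb_sub, hx, add_sub_cancel_right]
    exact LinearPMap.mem_domain_of_mem_graph huv
  obtain ⟨hw, hz⟩ := e.eq_zero_of_comb_mem_domain hS hJ he hu
  rw [sub_eq_zero] at hw hz
  rw [hz, hw]

theorem mapsGraph_extOfMatrix {C : H →L[ℂ] H} (hC : MapsGraph S C)
    (hC' : ∀ w, ∃ w', C (e.comb w (w ᵥ* U)) = e.comb w' (w' ᵥ* U))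
    (hCadj : MapsGraph S.adjoint C) : MapsGraph (extOfMatrix e U) C := by
  intro x y h
  obtain ⟨u, v, w, huv, rfl, rfl⟩ := (mem_graph_extOfMatrix hS hJ).1 h
  obtain ⟨w', hw'⟩ := hC' w
  have hx : C (u + e.comb w (w ᵥ* U)) = C u + e.comb w' (w' ᵥ* U) := by rw [map_add, hw']
  refine (mem_graph_extOfMatrix hS hJ).2 ⟨C u, C v, w', hC huv, hx, ?_⟩
  refine LinearPMap.mem_graph_snd_inj _ (hCadj (add_mem_graph ?_ ?_)) (add_mem_graph ?_ ?_) hx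
  exacts [mem_graph_adjoint_of_mem hS.dense hS.symm huv, e.comb_mem_graph_adjoint hS.dense hJ _ _,
    mem_graph_adjoint_of_mem hS.dense hS.symm (hC huv), e.comb_mem_graph_adjoint hS.dense hJ _ _]

end ExtOfMatrix

/-- A positive `J C` defines an inner product for which `A` is symmetric. -/
theorem SigmaJst.eq_zero_of_mem_graph {J : FundamentalSymmetry H} {A : H →ₗ.[ℂ] H}
    (hA : A ∈ SigmaJst J S) {n : H} {μ : ℂ} (hμ : conj μ ≠ μ) (h : (n, μ • n) ∈ A.graph) :
    n = 0 := by
  obtain ⟨hAJ, C, ⟨-, ⟨-, hpos⟩, -⟩, hAC⟩ := hA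
  have hform := SigmaJ.inner_op_eq hAJ (hAC.mapsGraph h) h
  rw [map_smul, map_smul, inner_smul_left, inner_smul_right] at hform
  have hneutral : ⟪(J.op * C) n, n⟫_ℂ = 0 :=
    (mul_eq_mul_right_iff.1 hform).resolve_left hμ
  by_contra hn
  exact (hpos n hn).ne' (by rw [hneutral, Complex.zero_re])

section ExtOfMatrix

variable {J : FundamentalSymmetry H} {e : DefectBasis J S} {U : Matrix (Fin 2) (Fin 2) ℂ}
  (hS : IsClosedSymmetric S) (hJ : MapsGraph S J.op)

include hS hJ

theorem commutes_op_extOfMatrix_iff (he : e.epp ≠ 0) :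
    Commutes (extOfMatrix e U) J.op ↔ U 0 0 = 0 ∧ U 1 1 = 0 := by
  have hiff : (∀ w, -(sgn * (w ᵥ* U)) = (sgn * w) ᵥ* U) ↔ U 0 0 = 0 ∧ U 1 1 = 0 := by
    simp only [funext_iff, Fin.forall_fin_two, Pi.neg_apply, Pi.mul_apply, Matrix.vecMul,
      dotProduct, Fin.sum_univ_two, sgn, Matrix.cons_val_zero, Matrix.cons_val_one]
    refine ⟨fun h => ⟨?_, ?_⟩, fun ⟨h0, h1⟩ w => ⟨?_, ?_⟩⟩
    · simpa [neg_eq_self] using (h ![1, 0]).1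
    · simpa [self_eq_neg] using (h ![0, 1]).2
    · linear_combination -2 * w 0 * h0
    · linear_combination 2 * w 1 * h1
  rw [← hiff]
  constructor
  · intro h w
    have hw := h.mapsGraph (comb_mem_graph_extOfMatrix hS hJ w)
    rw [e.op_comb] at hw
    exact eq_vecMul_of_comb_mem_domain hS hJ he (LinearPMap.mem_domain_of_mem_graph hw)
  · intro h
    refine MapsGraph.commutes ?_ J.sq_eq_one
    refine mapsGraph_extOfMatrix hS hJ hJ (fun w => ⟨sgn * w, ?_⟩) (J.mapsGraph_adjoint hS.dense hJ)
    rw [e.op_comb, h]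

theorem apply_zero_one_ne_zero_of_mem_SigmaJst (he : e.epp ≠ 0)
    (hA : extOfMatrix e U ∈ SigmaJst J S) : U 0 1 ≠ 0 := by
  intro h
  have hd := comb_mem_graph_extOfMatrix (e := e) (U := U) hS hJ ![1, 0]
  have hd0 : e.comb ![1, 0] (![1, 0] ᵥ* U) = 0 := by
    refine SigmaJst.eq_zero_of_mem_graph hA (μ := I) (by simp [neg_eq_self]) ?_
    convert hd using 3
    simp [DefectBasis.comb_eq, Matrix.vecMul, dotProduct, sgn, h]
  have hw := (e.eq_zero_of_comb_mem_domain hS hJ he (hd0 ▸ S.domain.zero_mem)).1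
  simpa using congrFun hw 0

end ExtOfMatrix

section Wandering

variable {𝕜 E : Type*} [RCLike 𝕜] [NormedAddCommGroup E] [InnerProductSpace 𝕜 E] [CompleteSpace E]

theorem inner_pow_right (T : E →L[𝕜] E) (n : ℕ) (x y : E) :
    ⟪x, (T ^ n) y⟫_𝕜 = ⟪(adjoint T ^ n) x, y⟫_𝕜 := by
  rw [← ContinuousLinearMap.star_eq_adjoint, ← star_pow, ContinuousLinearMap.star_eq_adjoint,
    ContinuousLinearMap.adjoint_inner_left]

theorem inner_pow_apply_pow_apply {B : E →L[𝕜] E} {N : Submodule 𝕜 E}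
    (h0 : ∀ x ∈ N, adjoint B x = 0)
    (h1 : ∀ x ∈ N, ∀ n, adjoint B ((B ^ (n + 1)) x) = (B ^ n) x) {x y : E} (hx : x ∈ N)
    (hy : y ∈ N) (n m : ℕ) : ⟪(B ^ n) x, (B ^ m) y⟫_𝕜 = if n = m then ⟪x, y⟫_𝕜 else 0 := by
  have hpow (n) (x : E) : (B ^ (n + 1)) x = B ((B ^ n) x) := by rw [pow_succ', mul_apply_eq_comp]
  induction n generalizing m with
  | zero =>
    cases m with
    | zero => simp
    | succ m => simp [hpow, ← ContinuousLinearMap.adjoint_inner_left, h0 x hx]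
  | succ n ih =>
    cases m with
    | zero => simp [hpow, ← ContinuousLinearMap.adjoint_inner_right, h0 y hy]
    | succ m =>
      rw [hpow m, ← ContinuousLinearMap.adjoint_inner_left, h1 x hx, ih]
      simp only [Nat.add_right_cancel_iff]

end Wandering

/-- The Cayley transform and its adjoint, as the operators for which the deficiency spaces `N_i`
(index `0`) and `N_{-i}` (index `1`) are wandering when the characteristic function vanishes. -/
noncomputable def shift (T : H →L[ℂ] H) : Fin 2 → H →L[ℂ] H := ![adjoint T, T]

namespace IsCayley

variable {T : H →L[ℂ] H} (hT : IsCayley S T) (hS : IsClosedSymmetric S)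

include hT hS

theorem adjoint_shift_apply {k : Fin 2} {x : H} (hx : x ∈ defectSpace S (I * sgn k)) :
    adjoint (shift T k) x = 0 := by
  fin_cases k
  · exact (DFunLike.congr_fun (ContinuousLinearMap.adjoint_adjoint T) x).trans
      (hT.map_defect (by simpa [sgn] using hx))
  · exact hT.adjoint_map_defect hS (by simpa [sgn] using hx)

theorem adjoint_shift_pow_succ_apply (hSh : HasZeroCharFunction S) {k : Fin 2} {x : H}
    (hx : x ∈ defectSpace S (I * sgn k)) (n : ℕ) :
    adjoint (shift T k) ((shift T k ^ (n + 1)) x) = (shift T k ^ n) x := by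
  rw [pow_succ', mul_apply_eq_comp]
  fin_cases k
  · refine (DFunLike.congr_fun (ContinuousLinearMap.adjoint_adjoint T) _).trans
      (hT.apply_adjoint_apply hS fun m hm => ?_)
    exact hT.inner_pow_adjoint_eq_zero hS hSh (by simpa [sgn] using hx) hm n
  · refine hT.adjoint_apply_apply hS fun m hm => ?_
    have h := hT.inner_pow_adjoint_eq_zero hS hSh hm (by simpa [sgn] using hx) n
    exact (inner_pow_right T n m x).trans (inner_eq_zero_symm.1 h)

theorem inner_shift_pow_apply (hSh : HasZeroCharFunction S) {k l : Fin 2} {x y : H}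
    (hx : x ∈ defectSpace S (I * sgn k)) (hy : y ∈ defectSpace S (I * sgn l)) (n m : ℕ) :
    ⟪(shift T k ^ n) x, (shift T l ^ m) y⟫_ℂ = if k = l ∧ n = m then ⟪x, y⟫_ℂ else 0 := by
  have hcross {x y : H} (hx : x ∈ defectSpace S I) (hy : y ∈ defectSpace S (-I)) (n m : ℕ) :
      ⟪(adjoint T ^ n) x, (T ^ m) y⟫_ℂ = 0 := by
    rw [inner_pow_right, ← mul_apply_eq_comp, ← pow_add]
    exact inner_eq_zero_symm.1 (hT.inner_pow_adjoint_eq_zero hS hSh hx hy _)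
  by_cases hkl : k = l
  · subst hkl
    simpa only [true_and] using inner_pow_apply_pow_apply (N := defectSpace S (I * sgn k))
      (fun _ => hT.adjoint_shift_apply hS) (fun _ => hT.adjoint_shift_pow_succ_apply hS hSh) hx hy
      n m
  · rw [if_neg fun h => hkl h.1]
    fin_cases k <;> fin_cases l
    · exact absurd rfl hkl
    · exact hcross (by simpa [sgn] using hx) (by simpa [sgn] using hy) n m
    · exact inner_eq_zero_symm.1
        (hcross (by simpa [sgn] using hy) (by simpa [sgn] using hx) m n)
    · exact absurd rfl hkl

end IsCayley

theorem span_range_smul_comp_perm {K M ι : Type*} [Field K] [AddCommGroup M] [Module K M]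
    {c : ι → K} (hc : ∀ i, c i ≠ 0) (τ : Equiv.Perm ι) {v : ι → M} :
    Submodule.span K (Set.range fun i => c i • v (τ i)) = Submodule.span K (Set.range v) := by
  refine le_antisymm (Submodule.span_le.2 ?_) (Submodule.span_le.2 ?_)
  · rintro _ ⟨i, rfl⟩
    exact Submodule.smul_mem _ _ (Submodule.subset_span ⟨τ i, rfl⟩)
  · rintro _ ⟨i, rfl⟩
    rw [SetLike.mem_coe, ← Submodule.smul_mem_iff _ (hc (τ.symm i))]
    exact Submodule.subset_span ⟨τ.symm i, by simp only [Equiv.apply_symm_apply]⟩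

theorem exists_linearIsometryEquiv_apply_eq_smul {𝕜 E ι : Type*} [RCLike 𝕜] [NormedAddCommGroup E]
    [InnerProductSpace 𝕜 E] [CompleteSpace E] (b : HilbertBasis ι 𝕜 E) (τ : Equiv.Perm ι)
    {c : ι → 𝕜} (hc : ∀ i, ‖c i‖ = 1) : ∃ U : E ≃ₗᵢ[𝕜] E, ∀ i, U (b i) = c i • b (τ i) := by
  classical
  have hon : Orthonormal 𝕜 fun i => c i • b (τ i) := by
    have hb := orthonormal_iff_ite.1 (b.orthonormal.comp τ τ.injective)
    refine orthonormal_iff_ite.2 fun i j => ?_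
    rw [inner_smul_left, inner_smul_right, ← Function.comp_apply (f := b),
      ← Function.comp_apply (f := b), hb]
    split_ifs with hij
    · rw [hij, mul_one, RCLike.conj_mul, hc, RCLike.ofReal_one, one_pow]
    · rw [mul_zero, mul_zero]
  have htop : ⊤ ≤ (Submodule.span 𝕜 (Set.range fun i => c i • b (τ i))).topologicalClosure := by
    rw [span_range_smul_comp_perm fun i => norm_ne_zero_iff.1 (by rw [hc]; exact one_ne_zero),
      b.dense_span]
  refine ⟨b.repr.trans (HilbertBasis.mk hon htop).repr.symm, fun i => ?_⟩
  rw [LinearIsometryEquiv.trans_apply, HilbertBasis.repr_self, HilbertBasis.repr_symm_single,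
    HilbertBasis.coe_mk]

namespace DefectBasis

variable {J : FundamentalSymmetry H}

/-- The orbits of the four defect vectors under the operators `shift T`; for a simple `S` with zero
characteristic function they form an orthogonal basis of `H`. -/
noncomputable def orbit (e : DefectBasis J S) (T : H →L[ℂ] H) (i : Bool × Fin 2 × ℕ) : H :=
  (shift T i.2.1 ^ i.2.2) (e.vec i.1 i.2.1)

variable {e : DefectBasis J S} {T : H →L[ℂ] H} (hT : IsCayley S T) (hS : IsClosedSymmetric S)
  (hJ : MapsGraph S J.op) (hSh : HasZeroCharFunction S)

include hT hS hJ hSh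

theorem inner_orbit (i j : Bool × Fin 2 × ℕ) :
    ⟪e.orbit T i, e.orbit T j⟫_ℂ = if i = j then (‖e.epp‖ : ℂ) ^ 2 else 0 := by
  obtain ⟨s, k, n⟩ := i
  obtain ⟨t, l, m⟩ := j
  have hvec (s k) := e.vec_mem_defectSpace hS.dense hJ s k
  rw [orbit, orbit, hT.inner_shift_pow_apply hS hSh (hvec s k) (hvec t l)]
  by_cases hkl : k = l
  · subst hkl
    simp only [e.inner_vec, true_and, Prod.mk.injEq, ← ite_and, and_comm]
  · simp [hkl]

theorem shift_apply_orbit (l : Fin 2) (s : Bool) (k : Fin 2) (n : ℕ) :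
    shift T l (e.orbit T (s, k, n)) =
      if l = k then e.orbit T (s, k, n + 1) else if n = 0 then 0 else e.orbit T (s, k, n - 1) := by
  have hvec := e.vec_mem_defectSpace hS.dense hJ s k
  split_ifs with hlk hn
  · subst hlk
    rw [orbit, orbit, pow_succ', mul_apply_eq_comp]
  all_goals
    have hlk : shift T l = adjoint (shift T k) := by
      fin_cases k <;> fin_cases l <;> simp_all [shift]
    rw [hlk]
  · subst hn
    exact hT.adjoint_shift_apply hS hvec
  · obtain ⟨m, rfl⟩ := Nat.exists_eq_succ_of_ne_zero hn
    exact hT.adjoint_shift_pow_succ_apply hS hSh hvec m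

theorem shift_apply_mem_span_orbit (l : Fin 2) {x : H}
    (hx : x ∈ Submodule.span ℂ (Set.range (e.orbit T))) :
    shift T l x ∈ Submodule.span ℂ (Set.range (e.orbit T)) := by
  suffices Submodule.span ℂ (Set.range (e.orbit T)) ≤
      (Submodule.span ℂ (Set.range (e.orbit T))).comap (shift T l : H →ₗ[ℂ] H) from this hx
  rw [Submodule.span_le]
  rintro _ ⟨⟨s, k, n⟩, rfl⟩
  rw [SetLike.mem_coe, Submodule.mem_comap, ContinuousLinearMap.coe_coe,
    shift_apply_orbit hT hS hJ hSh]
  split_ifs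
  exacts [Submodule.subset_span ⟨_, rfl⟩, zero_mem _, Submodule.subset_span ⟨_, rfl⟩]

variable (hsimple : IsSimple S)

include hsimple

theorem orthogonal_span_orbit_eq_bot : (Submodule.span ℂ (Set.range (e.orbit T)))ᗮ = ⊥ := by
  set L := Submodule.span ℂ (Set.range (e.orbit T))
  have hvec (s k) : e.vec s k ∈ L := Submodule.subset_span ⟨(s, k, 0), rfl⟩
  have hmap {A : H →L[ℂ] H} (hA : ∀ x ∈ L, adjoint A x ∈ L) : ∀ x ∈ Lᗮ, A x ∈ Lᗮ := by
    intro x hx u hu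
    rw [← ContinuousLinearMap.adjoint_inner_left]
    exact hx _ (hA u hu)
  refine hT.eq_bot_of_isSimple hS hsimple ?_ ?_ (hmap ?_) (hmap ?_)
  · rw [e.defectSpace_I hS.dense hJ]
    exact Submodule.orthogonal_le
      (Submodule.span_le.2 (Set.pair_subset (hvec true 0) (hvec false 0)))
  · rw [e.defectSpace_neg_I hS.dense hJ]
    exact Submodule.orthogonal_le
      (Submodule.span_le.2 (Set.pair_subset (hvec false 1) (hvec true 1)))
  · exact fun x hx => shift_apply_mem_span_orbit hT hS hJ hSh 0 hx
  · intro x hx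
    rw [ContinuousLinearMap.adjoint_adjoint]
    exact shift_apply_mem_span_orbit hT hS hJ hSh 1 hx

theorem ext_orbit {A B : H →L[ℂ] H} (h : ∀ i, A (e.orbit T i) = B (e.orbit T i)) : A = B := by
  refine ContinuousLinearMap.ext_on (s := Set.range (e.orbit T)) ?_ ?_
  · rw [Submodule.dense_iff_topologicalClosure_eq_top, Submodule.topologicalClosure_eq_top_iff]
    exact orthogonal_span_orbit_eq_bot hT hS hJ hSh hsimple
  · rintro _ ⟨i, rfl⟩
    exact h i

theorem ext_vec {A B : H →L[ℂ] H} (hA : ∀ k, Commute A (shift T k))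
    (hB : ∀ k, Commute B (shift T k)) (h : ∀ s k, A (e.vec s k) = B (e.vec s k)) : A = B := by
  refine ext_orbit (e := e) hT hS hJ hSh hsimple fun ⟨s, k, n⟩ => ?_
  have hAn := DFunLike.congr_fun ((hA k).pow_right n).eq (e.vec s k)
  have hBn := DFunLike.congr_fun ((hB k).pow_right n).eq (e.vec s k)
  rw [mul_apply_eq_comp, mul_apply_eq_comp] at hAn hBn
  rw [orbit, hAn, hBn, h]

theorem exists_hilbertBasis (he : e.epp ≠ 0) : ∃ b : HilbertBasis (Bool × Fin 2 × ℕ) ℂ H,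
    ∀ i, b i = (‖e.epp‖⁻¹ : ℂ) • e.orbit T i := by
  have he' : (‖e.epp‖ : ℂ) ≠ 0 := by simpa using he
  have hon : Orthonormal ℂ fun i => (‖e.epp‖⁻¹ : ℂ) • e.orbit T i := by
    rw [orthonormal_iff_ite]
    intro i j
    rw [inner_smul_left, inner_smul_right, inner_orbit hT hS hJ hSh, map_inv₀, Complex.conj_ofReal]
    split_ifs
    · field_simp
    · simp
  refine ⟨.mkOfOrthogonalEqBot hon ?_, fun i => by rw [HilbertBasis.coe_mkOfOrthogonalEqBot]⟩
  exact (congrArg _ (span_range_smul_comp_perm (fun _ => inv_ne_zero he') (.refl _))).trans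
    (orthogonal_span_orbit_eq_bot hT hS hJ hSh hsimple)

end DefectBasis

theorem IsCayley.commute_op_shift {T : H →L[ℂ] H} {J : FundamentalSymmetry H} (hT : IsCayley S T)
    (hS : IsClosedSymmetric S) (hJ : MapsGraph S J.op) (k : Fin 2) : Commute J.op (shift T k) := by
  have hJT : Commute J.op T := hT.commute_of_mapsGraph hS hJ fun _ hn =>
    (J.mapsGraph_adjoint hS.dense hJ).apply_mem_defectSpace hn
  have hJT' := hJT.star_star
  rw [J.isSelfAdjoint.star_eq] at hJT'
  fin_cases k
  exacts [hJT', hJT]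

/-- `R` is a unitary involution commuting with `S` and anticommuting with `J`, the second generator,
besides `J`, of a Clifford algebra of symmetries of `S`. -/
structure IsAnticommutingSymmetry (J : FundamentalSymmetry H) (S : H →ₗ.[ℂ] H) (R : H →L[ℂ] H) :
    Prop where
  isSelfAdjoint : IsSelfAdjoint R
  mul_self : R * R = 1
  mul_op : R * J.op = -(J.op * R)
  mapsGraph : MapsGraph S R

theorem IsAnticommutingSymmetry.mapsGraph_adjoint {J : FundamentalSymmetry H} {R : H →L[ℂ] H}
    (hR : IsAnticommutingSymmetry J S R) (hS : Dense (S.domain : Set H)) :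
    MapsGraph S.adjoint R :=
  MapsGraph.adjoint hS (by rw [hR.isSelfAdjoint.adjoint_eq]; exact hR.mapsGraph)

section ExistsAnticommutingSymmetry

variable {J : FundamentalSymmetry H} {e : DefectBasis J S} (hS : IsClosedSymmetric S)
  (hJ : MapsGraph S J.op) (hSh : HasZeroCharFunction S) (hsimple : IsSimple S)

include hS hJ hSh hsimple

theorem DefectBasis.exists_linearIsometryEquiv_commute {T : H →L[ℂ] H} (hT : IsCayley S T)
    (he : e.epp ≠ 0) {c : Bool → Fin 2 → ℂ} (hc : ∀ s k, ‖c s k‖ = 1) :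
    ∃ U : H ≃ₗᵢ[ℂ] H, (∀ k, Commute (U : H →L[ℂ] H) (shift T k)) ∧
      ∀ s k, U (e.vec s k) = c s k • e.vec (!s) k := by
  obtain ⟨b, hb⟩ := DefectBasis.exists_hilbertBasis (e := e) hT hS hJ hSh hsimple he
  obtain ⟨U, hU⟩ := exists_linearIsometryEquiv_apply_eq_smul b
    (Equiv.boolNot.prodCongr (.refl (Fin 2 × ℕ))) (c := fun i => c i.1 i.2.1) fun i => hc _ _
  have hUorbit (s k n) : U (e.orbit T (s, k, n)) = c s k • e.orbit T (!s, k, n) := by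
    have h := hU (s, k, n)
    rw [hb, hb, map_smul, smul_comm] at h
    exact smul_right_injective H (inv_ne_zero (by simpa using he)) h
  refine ⟨U, fun l => ?_, fun s k => hUorbit s k 0⟩
  refine DefectBasis.ext_orbit (e := e) hT hS hJ hSh hsimple fun ⟨s, k, n⟩ => ?_
  have hshift := DefectBasis.shift_apply_orbit (e := e) hT hS hJ hSh l
  change U (shift T l _) = shift T l (U _)
  rw [hUorbit, map_smul, hshift, hshift]
  split_ifs
  exacts [hUorbit s k _, by rw [map_zero, smul_zero], hUorbit s k _]

theorem exists_isAnticommutingSymmetry (he : e.epp ≠ 0) {d : Fin 2 → ℂ} (hd : ∀ k, ‖d k‖ = 1) :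
    ∃ R, IsAnticommutingSymmetry J S R ∧
      ∀ w z, R (e.comb w z) = e.comb (z * star d) (w * d) := by
  obtain ⟨T, hT⟩ := hS.exists_isCayley
  obtain ⟨U, hUT, hUe⟩ := DefectBasis.exists_linearIsometryEquiv_commute hS hJ hSh hsimple hT he
    (c := fun s k => if s then d k else conj (d k)) fun s k => by cases s <;> simp [hd]
  set R : H →L[ℂ] H := (U : H →L[ℂ] H)
  have hd' (k) : conj (d k) * d k = 1 := by rw [Complex.conj_mul', hd, Complex.ofReal_one, one_pow]
  have hRe (s k) : R (e.vec s k) = (if s then d k else conj (d k)) • e.vec (!s) k := hUe s k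
  have hRR : R * R = 1 := by
    refine DefectBasis.ext_vec (e := e) hT hS hJ hSh hsimple (fun k => (hUT k).mul_left (hUT k))
      (fun k => .one_left _) fun s k => ?_
    rw [mul_apply_eq_comp, hRe, map_smul, hRe, smul_smul, one_apply_eq_self]
    cases s <;> simp [hd', mul_comm (d k)]
  have hRadj : adjoint R = R := by
    refine ContinuousLinearMap.ext fun x => ext_inner_right ℂ fun y => ?_
    rw [ContinuousLinearMap.adjoint_inner_left, ← apply_apply_of_mul_self hRR x]
    exact (U.inner_map_map _ _).trans (by rw [apply_apply_of_mul_self hRR])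
  have hJT := hT.commute_op_shift hS hJ
  have hRJ : R * J.op = -(J.op * R) := by
    refine DefectBasis.ext_vec (e := e) hT hS hJ hSh hsimple (fun k => (hUT k).mul_left (hJT k))
      (fun k => ((hJT k).mul_left (hUT k)).neg_left) fun s k => ?_
    cases s <;>
      simp [mul_apply_eq_comp, hRe, e.op_vec_true, e.op_vec_false, smul_smul, mul_comm]
  refine ⟨R, ⟨hRadj, hRR, hRJ, hT.mapsGraph_of_commute hS (hUT 1) (hUT 0)⟩, fun w z => ?_⟩
  simp only [DefectBasis.comb, map_sum, map_add, map_smul, hRe, if_true, Bool.not_true,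
    Bool.not_false, Bool.false_eq_true, if_false, smul_smul, Pi.mul_apply, Pi.star_apply,
    RCLike.star_def]
  exact Finset.sum_congr rfl fun k _ => add_comm _ _

end ExistsAnticommutingSymmetry

section CSymmetries

theorem re_inner_smul_one_add_smul_pos {R : H →L[ℂ] H} (hR : IsSelfAdjoint R) (hRR : R * R = 1)
    {a b : ℝ} (hab : |b| < a) {x : H} (hx : x ≠ 0) :
    0 < (⟪((a : ℂ) • (1 : H →L[ℂ] H) + (b : ℂ) • R) x, x⟫_ℂ).re := by
  have hnorm : ‖R x‖ = ‖x‖ := by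
    rw [← sq_eq_sq₀ (norm_nonneg _) (norm_nonneg _), ← inner_self_eq_norm_sq (𝕜 := ℂ),
      ← inner_self_eq_norm_sq (𝕜 := ℂ), hR.isSymmetric.apply_clm, apply_apply_of_mul_self hRR]
  have hinner : |(⟪R x, x⟫_ℂ).re| ≤ ‖x‖ ^ 2 := by
    rw [sq]
    nth_rw 1 [← hnorm]
    exact (Complex.abs_re_le_norm _).trans (norm_inner_le_norm _ _)
  have hexpand : (⟪((a : ℂ) • (1 : H →L[ℂ] H) + (b : ℂ) • R) x, x⟫_ℂ).re =
      a * ‖x‖ ^ 2 + b * (⟪R x, x⟫_ℂ).re := by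
    rw [add_apply, smul_apply, smul_apply, one_apply_eq_self, inner_add_left, inner_smul_left,
      inner_smul_left, Complex.conj_ofReal, Complex.conj_ofReal, Complex.add_re,
      Complex.re_ofReal_mul, Complex.re_ofReal_mul, ← inner_self_eq_norm_sq (𝕜 := ℂ)]
    rfl
  have hx2 : 0 < ‖x‖ ^ 2 := pow_pos (norm_pos_iff.2 hx) 2
  have hbound : |b * (⟪R x, x⟫_ℂ).re| < a * ‖x‖ ^ 2 := by
    rw [abs_mul]
    exact (mul_le_mul_of_nonneg_left hinner (abs_nonneg b)).trans_lt
      (mul_lt_mul_of_pos_right hab hx2)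
  rw [hexpand]
  linarith [neg_lt_of_abs_lt hbound]

variable {J : FundamentalSymmetry H} {R : H →L[ℂ] H} {a b : ℝ}

theorem IsAnticommutingSymmetry.mul_self_op_mul (hR : IsAnticommutingSymmetry J S R)
    (hab : a ^ 2 - b ^ 2 = 1) :
    J.op * ((a : ℂ) • 1 + (b : ℂ) • R) * (J.op * ((a : ℂ) • 1 + (b : ℂ) • R)) = 1 := by
  have hab' : (a : ℂ) ^ 2 - (b : ℂ) ^ 2 = 1 := mod_cast hab
  have hflip : ((a : ℂ) • 1 + (b : ℂ) • R) * J.op = J.op * ((a : ℂ) • 1 - (b : ℂ) • R) := by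
    rw [add_mul, smul_mul_assoc, smul_mul_assoc, one_mul, hR.mul_op, mul_sub, mul_smul_comm,
      mul_smul_comm, mul_one, smul_neg, sub_eq_add_neg]
  rw [mul_assoc, ← mul_assoc _ J.op, hflip, ← mul_assoc, ← mul_assoc, J.sq_eq_one, one_mul]
  simp only [sub_mul, mul_add, smul_mul_assoc, mul_smul_comm, hR.mul_self, one_mul, mul_one]
  linear_combination (norm := module) hab' • (1 : H →L[ℂ] H)

theorem IsAnticommutingSymmetry.op_mul_mem_CSymmetries (hR : IsAnticommutingSymmetry J S R)
    (hJ : MapsGraph S J.op) (ha : 0 < a) (hab : a ^ 2 - b ^ 2 = 1) :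
    J.op * ((a : ℂ) • 1 + (b : ℂ) • R) ∈ CSymmetries J S := by
  have hCC := hR.mul_self_op_mul hab
  have hJC : J.op * (J.op * ((a : ℂ) • 1 + (b : ℂ) • R)) = (a : ℂ) • 1 + (b : ℂ) • R := by
    rw [← mul_assoc, J.sq_eq_one, one_mul]
  refine ⟨hCC, ?_, (hJ.mul ((MapsGraph.one.smul _).add (hR.mapsGraph.smul _))).commutes hCC⟩
  rw [hJC]
  have hreal (t : ℝ) : IsSelfAdjoint (t : ℂ) := Complex.conj_ofReal t
  refine ⟨((hreal a).smul (.one _)).add ((hreal b).smul hR.isSelfAdjoint), fun x hx => ?_⟩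
  exact re_inner_smul_one_add_smul_pos hR.isSelfAdjoint hR.mul_self
    (abs_lt_of_sq_lt_sq (by linarith) ha.le) hx

end CSymmetries

section UpsilonU

variable {J : FundamentalSymmetry H} {A : H →ₗ.[ℂ] H}

theorem mapsGraph_of_mem_UpsilonU (hJ : MapsGraph S J.op) (hA : A ∈ UpsilonU J S)
    {R : H →L[ℂ] H} (hR : IsAnticommutingSymmetry J S R) : MapsGraph A R := by
  have hAJ := (UpsilonU_subset_UpsilonJ (hJ.commutes J.sq_eq_one) hA).2.mapsGraph
  have hAC := (hA.2 _ (hR.op_mul_mem_CSymmetries (a := 5 / 4) (b := 3 / 4) hJ (by norm_num)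
    (by norm_num))).mapsGraph
  have h := ((hAJ.mul hAC).add (MapsGraph.one.smul (-(5 / 4) : ℂ))).smul (4 / 3 : ℂ)
  rw [← mul_assoc, J.sq_eq_one, one_mul] at h
  convert h using 1
  push_cast
  module

variable (hS : IsClosedSymmetric S) (hJ : MapsGraph S J.op) (hSh : HasZeroCharFunction S)
  (hsimple : IsSimple S) (e : DefectBasis J S) (he : e.epp ≠ 0)

include hS hJ hSh hsimple he

theorem eq_of_mem_UpsilonU (hA : A ∈ UpsilonU J S) : A = S := by
  obtain ⟨R₁, hR₁, hR₁comb⟩ := exists_isAnticommutingSymmetry (e := e) hS hJ hSh hsimple he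
    (d := 1) fun _ => norm_one
  obtain ⟨R₂, hR₂, hR₂comb⟩ := exists_isAnticommutingSymmetry (e := e) hS hJ hSh hsimple he
    (d := sgn) fun k => by fin_cases k <;> simp [sgn]
  have hstar : star sgn = sgn := by ext k; fin_cases k <;> simp [sgn]
  have hR (w z) : (R₁ * R₂) (e.comb w z) = e.comb (w * sgn) (z * sgn) := by
    rw [mul_apply_eq_comp, hR₂comb, hR₁comb, star_one, mul_one, mul_one, hstar]
  have hAR : MapsGraph A (R₁ * R₂) :=
    (mapsGraph_of_mem_UpsilonU hJ hA hR₁).mul (mapsGraph_of_mem_UpsilonU hJ hA hR₂)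
  have hSJ := hJ.commutes J.sq_eq_one
  have hAst := UpsilonJ_subset_SigmaJst hSJ (UpsilonU_subset_UpsilonJ hSJ hA)
  have hSA : S.graph ≤ A.graph := LinearPMap.le_graph_of_le hA.1.1
  refine graph_ext fun x y => ⟨fun h => ?_, fun h => hSA h⟩
  obtain ⟨u, v, w, z, huv, rfl, rfl⟩ := e.exists_comb_of_mem_graph_adjoint hS hJ
    (LinearPMap.le_graph_of_le (SigmaJ.le_adjoint hS.dense hJ hA.1) h)
  have hc : (e.comb w z, I • e.comb (sgn * w) (sgn * z)) ∈ A.graph := by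
    simpa using sub_mem_graph h (hSA huv)
  have hc' : (e.comb (sgn * w) (sgn * z), I • e.comb w z) ∈ A.graph := by
    have h := hAR hc
    rwa [map_smul, hR, hR, mul_comm w, mul_comm z, mul_right_comm, mul_right_comm sgn z,
      sgn_mul_sgn, one_mul, one_mul] at h
  have hadd : e.comb w z + e.comb (sgn * w) (sgn * z) = 0 :=
    SigmaJst.eq_zero_of_mem_graph hAst (μ := I) (by simp [neg_eq_self]) (by
      simpa [add_comm] using add_mem_graph hc hc')
  have hsub : e.comb w z - e.comb (sgn * w) (sgn * z) = 0 :=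
    SigmaJst.eq_zero_of_mem_graph hAst (μ := -I) (by simp [self_eq_neg]) (by
      simpa [smul_sub, neg_add_eq_sub] using sub_mem_graph hc hc')
  have hzero : e.comb w z = 0 := by linear_combination (norm := module) (1 / 2 : ℂ) • (hadd + hsub)
  have hzero' : e.comb (sgn * w) (sgn * z) = 0 := by rw [← hadd, hzero, zero_add]
  rwa [hzero, hzero', smul_zero, add_zero, add_zero]

theorem UpsilonU_eq_empty : UpsilonU J S = ∅ := by
  refine Set.eq_empty_of_forall_notMem fun A hA => he ?_
  have hSJ := hJ.commutes J.sq_eq_one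
  have hAst := UpsilonJ_subset_SigmaJst hSJ (UpsilonU_subset_UpsilonJ hSJ hA)
  have hmem : (e.epp : H) ∈ defectSpace S I := by
    rw [e.defectSpace_I hS.dense hJ]
    exact Submodule.subset_span (.inl rfl)
  have hgraph : ((e.epp : H), I • (e.epp : H)) ∈ (kreinAdjoint J A).graph := by
    rw [eq_of_mem_UpsilonU hS hJ hSh hsimple e he hA, mem_graph_kreinAdjoint]
    exact J.mapsGraph_adjoint hS.dense hJ (mem_defectSpace.1 hmem)
  rw [hA.1.2.2] at hgraph
  exact Subtype.ext (SigmaJst.eq_zero_of_mem_graph hAst (by simp [neg_eq_self]) hgraph)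

end UpsilonU

section Unitary

variable {U : Matrix (Fin 2) (Fin 2) ℂ}

theorem conj_exp_I_mul (θ : ℝ) : conj (Complex.exp (I * θ)) = Complex.exp (-(I * θ)) := by
  rw [← Complex.exp_conj, map_mul, Complex.conj_I, Complex.conj_ofReal, neg_mul]

theorem norm_exp_I_mul (θ : ℝ) : ‖Complex.exp (I * θ)‖ = 1 := by
  rw [mul_comm, Complex.norm_exp_ofReal_mul_I]

theorem exists_mem_Ico_eq_norm_mul_exp (z : ℂ) :
    ∃ θ ∈ Set.Ico 0 (2 * Real.pi), z = ‖z‖ * Complex.exp (I * θ) := by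
  have hper : Function.Periodic (fun t : ℝ => Complex.exp (I * t)) (2 * Real.pi) := fun t => by
    push_cast
    rw [mul_add, mul_comm I (2 * Real.pi), Complex.exp_periodic]
  obtain ⟨θ, hθ, h⟩ := hper.exists_mem_Ico₀ Real.two_pi_pos z.arg
  exact ⟨θ, hθ, by rw [← h, mul_comm I, Complex.norm_mul_exp_arg_mul_I]⟩

theorem eq_det_mul_conj_of_mem_unitaryGroup (hU : U ∈ Matrix.unitaryGroup (Fin 2) ℂ) :
    U 1 0 = -(U.det * conj (U 0 1)) ∧ U 1 1 = U.det * conj (U 0 0) := by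
  have hUU := Matrix.mem_unitaryGroup_iff.1 hU
  have hrow := congrFun₂ hUU 0 0
  have horth := congrFun₂ hUU 1 0
  simp only [Matrix.mul_apply, Fin.sum_univ_two, Matrix.star_apply, Matrix.one_apply_eq,
    Matrix.one_apply_ne (one_ne_zero : (1 : Fin 2) ≠ 0), RCLike.star_def] at hrow horth
  rw [Matrix.det_fin_two]
  constructor
  · linear_combination -U 1 0 * hrow + U 0 0 * horth
  · linear_combination -U 1 1 * hrow + U 0 1 * horth

theorem norm_sq_add_norm_sq_of_mem_unitaryGroup (hU : U ∈ Matrix.unitaryGroup (Fin 2) ℂ) :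
    ‖U 0 0‖ ^ 2 + ‖U 0 1‖ ^ 2 = 1 := by
  have hrow := congrFun₂ (Matrix.mem_unitaryGroup_iff.1 hU) 0 0
  simp only [Matrix.mul_apply, Fin.sum_univ_two, Matrix.star_apply, Matrix.one_apply_eq,
    RCLike.star_def, Complex.mul_conj'] at hrow
  exact_mod_cast hrow

theorem exists_eq_exp_smul_of_mem_unitaryGroup (hU : U ∈ Matrix.unitaryGroup (Fin 2) ℂ) :
    ∃ φ ∈ Set.Ico 0 (2 * Real.pi), ∃ a b : ℂ, ‖a‖ ^ 2 + ‖b‖ ^ 2 = 1 ∧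
      U = Complex.exp (I * φ) • !![a, b; -conj b, conj a] := by
  obtain ⟨θ, hθ, hdet⟩ := exists_mem_Ico_eq_norm_mul_exp U.det
  have hdet1 : ‖U.det‖ = 1 := CStarRing.norm_of_mem_unitary (Matrix.det_of_mem_unitary hU)
  rw [hdet1, Complex.ofReal_one, one_mul] at hdet
  refine ⟨θ / 2, ⟨by linarith [hθ.1], by linarith [hθ.1, hθ.2]⟩, ?_⟩
  generalize hw : Complex.exp (I * (θ / 2 : ℝ)) = w
  have hw1 : ‖w‖ = 1 := hw ▸ norm_exp_I_mul _
  have hwdet : U.det = w * w := by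
    rw [hdet, ← hw, ← Complex.exp_add, ← mul_add, ← Complex.ofReal_add, add_halves]
  have hwz (z : ℂ) : w * (conj w * z) = z := by
    rw [← mul_assoc, Complex.mul_conj', hw1, Complex.ofReal_one, one_pow, one_mul]
  have hnorm (z : ℂ) : ‖conj w * z‖ = ‖z‖ := by rw [norm_mul, RCLike.norm_conj, hw1, one_mul]
  obtain ⟨h10, h11⟩ := eq_det_mul_conj_of_mem_unitaryGroup hU
  refine ⟨conj w * U 0 0, conj w * U 0 1, ?_, ?_⟩
  · rw [hnorm, hnorm, norm_sq_add_norm_sq_of_mem_unitaryGroup hU]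
  · ext i j
    fin_cases i <;> fin_cases j <;> simp [hwz, h10, h11, hwdet, mul_assoc]

theorem exists_polar_of_mem_unitaryGroup (hU : U ∈ Matrix.unitaryGroup (Fin 2) ℂ) :
    ∃ φ ∈ Set.Ico 0 (2 * Real.pi), ∃ γ ∈ Set.Ico 0 (2 * Real.pi), ∃ ξ ∈ Set.Ico 0 (2 * Real.pi),
      ∃ q r : ℝ, 0 ≤ q ∧ 0 ≤ r ∧ q ^ 2 + r ^ 2 = 1 ∧
      U = Complex.exp (I * φ) •
        !![q * Complex.exp (I * γ), r * Complex.exp (I * ξ);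
           -(r * Complex.exp (-(I * ξ))), q * Complex.exp (-(I * γ))] := by
  obtain ⟨φ, hφ, a, b, hab, rfl⟩ := exists_eq_exp_smul_of_mem_unitaryGroup hU
  obtain ⟨γ, hγ, ha⟩ := exists_mem_Ico_eq_norm_mul_exp a
  obtain ⟨ξ, hξ, hb⟩ := exists_mem_Ico_eq_norm_mul_exp b
  refine ⟨φ, hφ, γ, hγ, ξ, hξ, ‖a‖, ‖b‖, norm_nonneg a, norm_nonneg b, hab, ?_⟩
  have hconj (z : ℂ) (θ : ℝ) (h : z = ‖z‖ * Complex.exp (I * θ)) :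
      ‖z‖ * Complex.exp (-(I * θ)) = conj z := by
    rw [← conj_exp_I_mul, ← Complex.conj_ofReal, ← map_mul, ← h]
  rw [hconj a γ ha, hconj b ξ hb, ← ha, ← hb]

theorem apply_zero_zero_eq_zero_iff_of_mem_unitaryGroup
    (hU : U ∈ Matrix.unitaryGroup (Fin 2) ℂ) :
    U 0 0 = 0 ↔ ∃ φ ∈ Set.Ico 0 (2 * Real.pi), ∃ ξ ∈ Set.Ico 0 (2 * Real.pi),
      U = Complex.exp (I * φ) •
        !![0, Complex.exp (I * ξ); -Complex.exp (-(I * ξ)), 0] := by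
  constructor
  · obtain ⟨φ, hφ, γ, -, ξ, hξ, q, r, -, hr, hqr, rfl⟩ := exists_polar_of_mem_unitaryGroup hU
    intro h
    obtain rfl : q = 0 := by simpa using h
    obtain rfl : r = 1 := by
      rwa [zero_pow two_ne_zero, zero_add, pow_eq_one_iff_of_nonneg hr two_ne_zero] at hqr
    exact ⟨φ, hφ, ξ, hξ, by simp⟩
  · rintro ⟨φ, -, ξ, -, rfl⟩
    simp

theorem apply_ne_zero_iff_of_mem_unitaryGroup (hU : U ∈ Matrix.unitaryGroup (Fin 2) ℂ) :
    U 0 1 ≠ 0 ∧ U 0 0 ≠ 0 ↔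
      ∃ φ ∈ Set.Ico 0 (2 * Real.pi), ∃ γ ∈ Set.Ico 0 (2 * Real.pi),
        ∃ ξ ∈ Set.Ico 0 (2 * Real.pi), ∃ q r : ℝ, 0 < q ∧ 0 < r ∧ q ^ 2 + r ^ 2 = 1 ∧
        U = Complex.exp (I * φ) •
          !![q * Complex.exp (I * γ), r * Complex.exp (I * ξ);
             -(r * Complex.exp (-(I * ξ))), q * Complex.exp (-(I * γ))] := by
  constructor
  · obtain ⟨φ, hφ, γ, hγ, ξ, hξ, q, r, hq, hr, hqr, rfl⟩ := exists_polar_of_mem_unitaryGroup hU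
    rintro ⟨h01, h00⟩
    exact ⟨φ, hφ, γ, hγ, ξ, hξ, q, r, hq.lt_of_ne' (by simpa using h00),
      hr.lt_of_ne' (by simpa using h01), hqr, rfl⟩
  · rintro ⟨φ, -, γ, -, ξ, -, q, r, hq, hr, -, rfl⟩
    simp [hq.ne', hr.ne']

theorem rotation_mem_unitaryGroup {a b : ℝ} (h : a ^ 2 + b ^ 2 = 1) :
    !![(a : ℂ), b; -b, a] ∈ Matrix.unitaryGroup (Fin 2) ℂ := by
  have h' : (a : ℂ) ^ 2 + (b : ℂ) ^ 2 = 1 := mod_cast h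
  rw [Matrix.mem_unitaryGroup_iff]
  ext i j
  fin_cases i <;> fin_cases j <;> simp [Matrix.mul_apply, Fin.sum_univ_two, ← h'] <;> ring

end Unitary

section SigmaJst

variable {U : Matrix (Fin 2) (Fin 2) ℂ}

/-- The signs are those of `J` on `N_i ∔ N_{-i}`; with `C = J (1 - q R) / r`, the identity says that
`C` maps the graph of `U` to itself. -/
theorem exists_phases_vecMul (hU : U ∈ Matrix.unitaryGroup (Fin 2) ℂ) :
    ∃ d : Fin 2 → ℂ, (∀ k, ‖d k‖ = 1) ∧ ∀ w : Fin 2 → ℂ,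
      (sgn * (w - (‖U 0 0‖ : ℂ) • (w ᵥ* U * star d))) ᵥ* U =
        -(sgn * (w ᵥ* U - (‖U 0 0‖ : ℂ) • (w * d))) := by
  obtain ⟨φ, -, a, b, hab, rfl⟩ := exists_eq_exp_smul_of_mem_unitaryGroup hU
  obtain ⟨θ, -, ha⟩ := exists_mem_Ico_eq_norm_mul_exp a
  generalize hp : Complex.exp (I * φ) = p
  generalize hα : Complex.exp (I * θ) = α at ha
  have hp1 : ‖p‖ = 1 := hp ▸ norm_exp_I_mul φ
  have hα1 : ‖α‖ = 1 := hα ▸ norm_exp_I_mul θ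
  have hpp : p * conj p = 1 := by rw [Complex.mul_conj', hp1, Complex.ofReal_one, one_pow]
  have hαα : α * conj α = 1 := by rw [Complex.mul_conj', hα1, Complex.ofReal_one, one_pow]
  have ha' : conj a = ‖a‖ * conj α := by rw [← Complex.conj_ofReal, ← map_mul, ← ha]
  have hab' : (‖a‖ : ℂ) ^ 2 + b * conj b = 1 := by
    rw [Complex.mul_conj']
    exact_mod_cast hab
  have hnorm : ‖(p • !![a, b; -conj b, conj a]) 0 0‖ = ‖a‖ := by simp [hp1]
  refine ⟨![p * α, p * conj α], fun k => by fin_cases k <;> simp [hp1, hα1], fun w => ?_⟩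
  rw [hnorm]
  generalize (‖a‖ : ℂ) = q at *
  subst ha
  rw [funext_iff, Fin.forall_fin_two]
  simp only [Matrix.vecMul, dotProduct, sgn, Fin.sum_univ_two, Matrix.smul_apply, smul_eq_mul,
    Matrix.of_apply, Matrix.cons_val_zero, Matrix.cons_val_one, Pi.mul_apply, Pi.sub_apply,
    Pi.neg_apply, Pi.smul_apply, Pi.star_apply, RCLike.star_def, map_mul, Complex.conj_conj, ha']
  constructor <;> grind

variable {J : FundamentalSymmetry H} {e : DefectBasis J S} (hS : IsClosedSymmetric S)
  (hJ : MapsGraph S J.op)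

include hS hJ

theorem extOfMatrix_mem_UpsilonJ_iff (he : e.epp ≠ 0) (hU : U ∈ Matrix.unitaryGroup (Fin 2) ℂ) :
    extOfMatrix e U ∈ UpsilonJ J S ↔ U 0 0 = 0 := by
  have h11 : U 0 0 = 0 → U 1 1 = 0 := fun h => by
    rw [(eq_det_mul_conj_of_mem_unitaryGroup hU).2, h, map_zero, mul_zero]
  calc extOfMatrix e U ∈ UpsilonJ J S
      ↔ Commutes (extOfMatrix e U) J.op := and_iff_right (extOfMatrix_mem_SigmaJ hS hJ he hU)
    _ ↔ U 0 0 = 0 ∧ U 1 1 = 0 := commutes_op_extOfMatrix_iff hS hJ he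
    _ ↔ U 0 0 = 0 := and_iff_left_of_imp h11

variable (hSh : HasZeroCharFunction S) (hsimple : IsSimple S)

include hSh hsimple

theorem extOfMatrix_mem_SigmaJst (he : e.epp ≠ 0) (hU : U ∈ Matrix.unitaryGroup (Fin 2) ℂ)
    (h01 : U 0 1 ≠ 0) : extOfMatrix e U ∈ SigmaJst J S := by
  obtain ⟨d, hd, hdU⟩ := exists_phases_vecMul hU
  obtain ⟨R, hR, hRe⟩ := exists_isAnticommutingSymmetry (e := e) hS hJ hSh hsimple he hd
  set q : ℝ := ‖U 0 0‖
  set r : ℝ := ‖U 0 1‖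
  have hr : 0 < r := norm_pos_iff.2 h01
  have hqr : r⁻¹ ^ 2 - (-(r⁻¹ * q)) ^ 2 = 1 := by
    have hrow := norm_sq_add_norm_sq_of_mem_unitaryGroup hU
    field_simp
    exact sub_eq_of_eq_add' hrow.symm
  set C : H →L[ℂ] H := J.op * (((r⁻¹ : ℝ) : ℂ) • 1 + ((-(r⁻¹ * q) : ℝ) : ℂ) • R)
  have hCU : C ∈ CSymmetries J S := hR.op_mul_mem_CSymmetries hJ (inv_pos.2 hr) hqr
  have hCe (w z) : C (e.comb w z) = (r : ℂ)⁻¹ • e.comb (sgn * (w - (q : ℂ) • (z * star d)))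
      (-(sgn * (z - (q : ℂ) • (w * d)))) := by
    have hsub : C (e.comb w z) = (r : ℂ)⁻¹ • J.op (e.comb w z - (q : ℂ) • R (e.comb w z)) := by
      simp only [C, mul_apply_eq_comp, add_apply, smul_apply, one_apply_eq_self,
        map_add, map_sub, map_smul]
      push_cast
      module
    rw [hsub, hRe, ← e.comb_smul, ← e.comb_sub, e.op_comb]
  have hCadj : MapsGraph S.adjoint C := (J.mapsGraph_adjoint hS.dense hJ).mul
    ((MapsGraph.one.smul _).add ((hR.mapsGraph_adjoint hS.dense).smul _))
  have hCA : MapsGraph (extOfMatrix e U) C :=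
    mapsGraph_extOfMatrix hS hJ hCU.2.2.mapsGraph (fun w => ⟨_, by
      rw [hCe, ← hdU, ← e.comb_smul, ← Matrix.smul_vecMul]⟩) hCadj
  exact ⟨extOfMatrix_mem_SigmaJ hS hJ he hU, C, hCU, hCA.commutes hCU.1⟩

theorem extOfMatrix_mem_SigmaJst_iff (he : e.epp ≠ 0)
    (hU : U ∈ Matrix.unitaryGroup (Fin 2) ℂ) : extOfMatrix e U ∈ SigmaJst J S ↔ U 0 1 ≠ 0 :=
  ⟨apply_zero_one_ne_zero_of_mem_SigmaJst hS hJ he,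
    extOfMatrix_mem_SigmaJst hS hJ hSh hsimple he hU⟩

end SigmaJst

end KreinExt

theorem theorem4p5 {H : Type*} [NormedAddCommGroup H] [InnerProductSpace ℂ H] [CompleteSpace H]
    (J : KreinExt.FundamentalSymmetry H) (S : H →ₗ.[ℂ] H)
    (hS_dense : Dense (S.domain : Set H)) (hS_closed : S.IsClosed)
    (hS_symm : S.IsFormalAdjoint S) (hSJ : KreinExt.Commutes S J.op)
    (hS_plus : KreinExt.HasDeficiencyIndicesOne (KreinExt.part S J.plus))
    (hS_minus : KreinExt.HasDeficiencyIndicesOne (KreinExt.part S J.minus))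
    (hS_simple : KreinExt.IsSimple S) (hSh : KreinExt.HasZeroCharFunction S) :
    KreinExt.UpsilonU J S = ∅ ∧
    KreinExt.UpsilonU J S ⊂ KreinExt.UpsilonJ J S ∧
    KreinExt.UpsilonJ J S ⊂ KreinExt.SigmaJst J S ∧
    ∀ e : KreinExt.DefectBasis J S, ∀ U ∈ Matrix.unitaryGroup (Fin 2) ℂ,
      (KreinExt.extOfMatrix e U ∈ KreinExt.UpsilonJ J S ↔
        ∃ φ ∈ Set.Ico 0 (2 * Real.pi), ∃ ξ ∈ Set.Ico 0 (2 * Real.pi),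
          U = Complex.exp (Complex.I * φ) •
            !![0, Complex.exp (Complex.I * ξ);
               -Complex.exp (-(Complex.I * ξ)), 0]) ∧
      (KreinExt.extOfMatrix e U ∈ KreinExt.SigmaJst J S \ KreinExt.UpsilonJ J S ↔
        ∃ φ ∈ Set.Ico 0 (2 * Real.pi), ∃ γ ∈ Set.Ico 0 (2 * Real.pi),
          ∃ ξ ∈ Set.Ico 0 (2 * Real.pi), ∃ q r : ℝ, 0 < q ∧ 0 < r ∧ q ^ 2 + r ^ 2 = 1 ∧
          U = Complex.exp (Complex.I * φ) •
            !![q * Complex.exp (Complex.I * γ), r * Complex.exp (Complex.I * ξ);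
               -(r * Complex.exp (-(Complex.I * ξ))), q * Complex.exp (-(Complex.I * γ))]) := by
  have hS : KreinExt.IsClosedSymmetric S := ⟨hS_dense, hS_closed, hS_symm⟩
  have hJ := hSJ.mapsGraph
  have hUpsilonJ (e : KreinExt.DefectBasis J S) {U} (hU : U ∈ Matrix.unitaryGroup (Fin 2) ℂ) :=
    KreinExt.extOfMatrix_mem_UpsilonJ_iff hS hJ (e.epp_ne_zero hS_plus) hU
  have hSigmaJst (e : KreinExt.DefectBasis J S) {U} (hU : U ∈ Matrix.unitaryGroup (Fin 2) ℂ) :=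
    KreinExt.extOfMatrix_mem_SigmaJst_iff hS hJ hSh hS_simple (e.epp_ne_zero hS_plus) hU
  obtain ⟨e₀⟩ := KreinExt.DefectBasis.nonempty hS_plus hS_minus
  have hempty :=
    KreinExt.UpsilonU_eq_empty hS hJ hSh hS_simple e₀ (e₀.epp_ne_zero hS_plus)
  refine ⟨hempty, ?_, ⟨KreinExt.UpsilonJ_subset_SigmaJst hSJ, fun hsub => ?_⟩,
    fun e U hU => ⟨?_, ?_⟩⟩
  · rw [hempty, Set.empty_ssubset]
    have hU := KreinExt.rotation_mem_unitaryGroup (a := 0) (b := 1) (by norm_num)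
    exact ⟨_, (hUpsilonJ e₀ hU).2 (by simp)⟩
  · have hU := KreinExt.rotation_mem_unitaryGroup (a := 3 / 5) (b := 4 / 5) (by norm_num)
    have h := (hUpsilonJ e₀ hU).1 (hsub ((hSigmaJst e₀ hU).2 (by simp)))
    simp at h
  · rw [hUpsilonJ e hU, KreinExt.apply_zero_zero_eq_zero_iff_of_mem_unitaryGroup hU]
  · rw [Set.mem_sdiff, hSigmaJst e hU, hUpsilonJ e hU,
      KreinExt.apply_ne_zero_iff_of_mem_unitaryGroup hU]
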